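/- Let $X,Y$ be (real or complex) Hilbert spaces and $T:X\to Y$ a bounded linear operator with $\ker T=\{0\}$ and $\ker T^*=\{0\}$; let $F_\lambda$ be the spectral family of $TT^*$. Let $\varphi,\kappa:(0,\infty)\to[0,\infty)$ be continuous and (weakly) increasing, $\kappa\not\equiv 0$, let $(\lambda,\alpha)\mapsto g_\alpha(\lambda)\in\mathbb R$ be continuous on $(0,\infty)^2$, and assume that there are constants $c_1,\dots,c_7>0$ such that the following structural conditions hold. 1. For all $\alpha,\lambda>0$: $0\le \lambda g_\alpha(\lambda)\le 1$ and $\sqrt\lambda\, g_\alpha(\lambda)\le c_1/\sqrt\alpha$. 2. For all $\alpha>0$ and $\lambda\in(0,\alpha)$: $1-\lambda g_\alpha(\lambda)\ge c_2$ and $c_3/\alpha\le g_\alpha(\lambda)\le c_4/\alpha$. 3. For every $\lambda>0$: $\inf_{\alpha\in(0,\|T\|]}\frac{(1-\lambda g_\alpha(\lambda))\,g_\alpha(\lambda)}{\alpha}>0$. 4. For all $\alpha>0$: $\sup_{\lambda>0}|\varphi(\lambda)(1-\lambda g_\alpha(\lambda))|\le c_5\varphi(\alpha)$ and $\sup_{\lambda>0}|\kappa(\lambda)\varphi(\lambda)(1-\lambda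 g_\alpha(\lambda))|\le c_6\kappa(\alpha)\varphi(\alpha)$. 5. For all $\alpha>0$: $\sup_{\lambda>\alpha}\kappa(\lambda)/\sqrt\lambda\le c_7\,\kappa(\alpha)/\sqrt\alpha$. 6. For every $c_8>0$ there are $c_9>0$ and $\delta_0>0$ such that $\varphi(c_8\delta)\le c_9\varphi(\delta)$ and $\kappa(c_8\delta)\le c_9\kappa(\delta)$ for all $\delta\in(0,\delta_0)$. Let $x\in\operatorname{Ran}(\varphi(T^*T))$, $f\in\operatorname{Ran}(\kappa(T^*T))$, $y=Tx\neq0$, and let $y^\delta\in Y$ satisfy $\|y^\delta-y\|\le\delta$ for $\delta\in(0,1)$. Assume the generalized Muckenhoupt-type noise condition: there are $c_{10},\delta_0>0$ such that for all $\delta\in(0,\delta_0)$ and all $\alpha>0$ $$\alpha^2\int_{(\alpha,\infty)}\lambda^{-1}\kappa^2(\lambda)\,d\|F_\lambda(y^\delta-y)\|^2\le c_{10}\int_{(0,\alpha]}\lambda\,\kappa^2(\lambda)\,d\|F_\lambda(y^\delta-y)\|^2 .$$ Put $x_\alpha^\delta=g_\alpha(T^*T)T^*y^\delta$, $$\psi(\alpha,y^\delta)=\|(I-T^*Tg_\alpha(T^*T))x_\alpha^\delta\|,\qquad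 \psi_\kappa(\alpha,y^\delta)=\|\kappa(T^*T)(I-T^*Tg_\alpha(T^*T))x_\alpha^\delta\|,$$ and $\theta(t)=\varphi(t)\sqrt t$ for $t>0$, with inverse function $\theta^{-1}$. Fix $a\in(0,\|T\|]$, and let $\alpha(y^\delta)$ and $\alpha_\kappa(y^\delta)$ denote any minimizers over $\alpha\in(0,a]$ of $\psi(\cdot,y^\delta)$ and of $\psi_\kappa(\cdot,y^\delta)$, respectively. Then, as $\delta\to0$ (over those $\delta$ for which the minimizer in question exists, and with constants that depend neither on $\delta$ nor on the choice of the minimizer), where $\vee$ is the maximum, $$\|x^\delta_{\alpha(y^\delta)}-x\|=O\bigl(\varphi(\varphi(\theta^{-1}(\delta)))\vee\varphi(\theta^{-1}(\delta))\bigr),$$ $$|\langle f,x^\delta_{\alpha(y^\delta)}-x\rangle|=O\bigl((\kappa\varphi)(\varphi(\theta^{-1}(\delta)))\vee\varphi(\theta^{-1}(\delta))\bigr),$$ $$|\langle f,x^\delta_{\alpha_\kappa(y^\delta)}-x\rangle|=O\bigl((\kappa\varphi)((\kappa\varphi)(\theta^{-1}(\delta)))\vee(\kappa\varphi)(\theta^{-1}(\delta))\bigr).$$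 -/

import Mathlib

open Set Filter Topology MeasureTheory

namespace FunctionalStrategy

noncomputable section

section SpectralCalculus

variable {𝕜 H : Type*} [RCLike 𝕜] [NormedAddCommGroup H] [InnerProductSpace 𝕜 H]

/-- `μ` is the scalar spectral measure `d‖E_t v‖²` of the bounded positive self-adjoint
operator `A` at the vector `v`, where `E_t` is the spectral family of `A`: the finite Borel measure
carried by `[0, ‖A‖]` with `∫ tⁿ d‖E_t v‖² = ⟨v, Aⁿ v⟩` for all `n`. A compactly supported measure
is determined by its moments, so there is at most one such measure; for positive `A` it exists by
the spectral theorem. -/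
def IsSpectralMeasure (A : H →L[𝕜] H) (v : H) (μ : Measure ℝ) : Prop :=
  IsFiniteMeasure μ ∧ μ (Icc 0 ‖A‖)ᶜ = 0 ∧
    ∀ n : ℕ, ∫ t, t ^ n ∂μ = RCLike.re (inner 𝕜 v ((A ^ n) v))

/-- The scalar spectral measure `d‖E_t v‖²` of the positive operator `A` at `v`. -/
def spectralMeasure (A : H →L[𝕜] H) (v : H) : Measure ℝ :=
  Classical.epsilon (IsSpectralMeasure A v)

variable [CompleteSpace H]

/-- `B = h(A) = ∫ h(t) dE_t`, for a real Borel function `h` that is bounded on the spectrum of the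
positive operator `A`: the self-adjoint operator with `⟨v, B v⟩ = ∫ h(t) d‖E_t v‖²` for all `v`
(unique, since a self-adjoint operator is determined by its quadratic form). -/
def IsFunctionOf (A : H →L[𝕜] H) (h : ℝ → ℝ) (B : H →L[𝕜] H) : Prop :=
  IsSelfAdjoint B ∧
    ∀ v : H, RCLike.re (inner 𝕜 v (B v)) = ∫ t, h t ∂(spectralMeasure A v)

/-- The operator `h(A)` of the bounded Borel functional calculus of the positive operator `A`. -/
def funCalc (A : H →L[𝕜] H) (h : ℝ → ℝ) : H →L[𝕜] H :=
  Classical.epsilon (IsFunctionOf A h)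

end SpectralCalculus

/-- Continuous, non-negative, (weakly) increasing functions on `(0, ∞)`;
values at `t ≤ 0` are irrelevant. -/
structure IsIndexFunction (φ : ℝ → ℝ) : Prop where
  continuousOn : ContinuousOn φ (Ioi 0)
  nonneg : ∀ t, 0 < t → 0 ≤ φ t
  monotoneOn : MonotoneOn φ (Ioi 0)

/-- `θ(t) = φ(t) √t`. -/
def theta (φ : ℝ → ℝ) (t : ℝ) : ℝ := φ t * √t

/-- The inverse function of `θ : (0, ∞) → (0, ∞)`. -/
def thetaInv (φ : ℝ → ℝ) (δ : ℝ) : ℝ := Function.invFunOn (theta φ) (Ioi 0) δ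

section Regularization

variable {𝕜 X Y : Type*} [RCLike 𝕜]
  [NormedAddCommGroup X] [InnerProductSpace 𝕜 X] [CompleteSpace X]
  [NormedAddCommGroup Y] [InnerProductSpace 𝕜 Y] [CompleteSpace Y]

/-- `T* T` on `X`. -/
def TstarT (T : X →L[𝕜] Y) : X →L[𝕜] X := ContinuousLinearMap.adjoint T ∘L T

/-- `T T*` on `Y`. -/
def TTstar (T : X →L[𝕜] Y) : Y →L[𝕜] Y := T ∘L ContinuousLinearMap.adjoint T

/-- The regularized solution `g_α(T*T) T* z` for the data `z`; here `g α t` stands for `g_α(t)`. -/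
def regSol (T : X →L[𝕜] Y) (g : ℝ → ℝ → ℝ) (α : ℝ) (z : Y) : X :=
  funCalc (TstarT T) (g α) (ContinuousLinearMap.adjoint T z)

/-- `(I - T*T g_α(T*T)) g_α(T*T) T* z`. -/
def qoResidual (T : X →L[𝕜] Y) (g : ℝ → ℝ → ℝ) (α : ℝ) (z : Y) : X :=
  regSol T g α z - TstarT T (funCalc (TstarT T) (g α) (regSol T g α z))

/-- The quasi-optimality functional `ψ(α, z)`. -/
def psi (T : X →L[𝕜] Y) (g : ℝ → ℝ → ℝ) (α : ℝ) (z : Y) : ℝ :=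
  ‖qoResidual T g α z‖

/-- The modified quasi-optimality functional `ψ_κ(α, z)`. -/
def psiKappa (T : X →L[𝕜] Y) (g : ℝ → ℝ → ℝ) (κ : ℝ → ℝ) (α : ℝ) (z : Y) : ℝ :=
  ‖funCalc (TstarT T) κ (qoResidual T g α z)‖

/-- `α` is a minimizer of `F` over the parameter interval `(0, a]`. -/
def IsArgmin (F : ℝ → ℝ) (a α : ℝ) : Prop :=
  α ∈ Ioc 0 a ∧ ∀ β ∈ Ioc 0 a, F α ≤ F β

/-- The structural conditions on the filter functions `g_α` and the index functions `φ`, `κ`. -/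
structure StructuralAssumption (T : X →L[𝕜] Y) (g : ℝ → ℝ → ℝ) (φ κ : ℝ → ℝ) : Prop where
  filter_range : ∀ α > 0, ∀ t > 0, 0 ≤ t * g α t ∧ t * g α t ≤ 1
  filter_sqrt : ∃ c₁ > 0, ∀ α > 0, ∀ t > 0, √t * g α t ≤ c₁ / √α
  residual_lower : ∃ c₂ > 0, ∀ α > 0, ∀ t ∈ Ioo 0 α, c₂ ≤ 1 - t * g α t
  filter_two_sided : ∃ c₃ > 0, ∃ c₄ > 0, ∀ α > 0, ∀ t ∈ Ioo 0 α,
    c₃ / α ≤ g α t ∧ g α t ≤ c₄ / α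
  lower_qualification : ∀ t > 0,
    0 < ⨅ α : Ioc (0 : ℝ) ‖T‖, (1 - t * g α t) * g α t / (α : ℝ)
  qualification : ∃ c₅ > 0, ∀ α > 0, ∀ t > 0, |φ t * (1 - t * g α t)| ≤ c₅ * φ α
  qualification_kappa : ∃ c₆ > 0, ∀ α > 0, ∀ t > 0,
    |κ t * φ t * (1 - t * g α t)| ≤ c₆ * (κ α * φ α)
  kappa_covered : ∃ c₇ > 0, ∀ α > 0, ∀ t > α, κ t / √t ≤ c₇ * (κ α / √α)
  regular_variation : ∀ c₈ > 0, ∃ c₉ > 0, ∃ δ₀ > 0, ∀ δ ∈ Ioo 0 δ₀,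
    φ (c₈ * δ) ≤ c₉ * φ δ ∧ κ (c₈ * δ) ≤ c₉ * κ δ

/-- The generalized Muckenhoupt-type noise condition for noisy data `yδ δ` of `y`; the measure is
`d‖F_t (y^δ - y)‖²` with `F_t` the spectral family of `T T*`. -/
def NoiseCondition (T : X →L[𝕜] Y) (κ : ℝ → ℝ) (y : Y) (yδ : ℝ → Y) : Prop :=
  ∃ c₁₀ > 0, ∃ δ₀ > 0, ∀ δ ∈ Ioo 0 δ₀, ∀ α > 0,
    α ^ 2 * ∫ t in Ioi α, t⁻¹ * κ t ^ 2 ∂(spectralMeasure (TTstar T) (yδ δ - y))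
      ≤ c₁₀ * ∫ t in Ioc 0 α, t * κ t ^ 2 ∂(spectralMeasure (TTstar T) (yδ δ - y))

end Regularization

end

end FunctionalStrategy

/-! Write r_α(t) = 1 - t g_α(t), A = T*T and x = φ(A)w. Applying κ(A) to the error splits it into
propagated noise and approximation error: κ(A)(x_α^δ - x) = (κ g_α)(A) T*(y^δ - y) - (κ φ r_α)(A) w.
The last term is O(κ(α)φ(α)) by the qualification (`exists_norm_error_le`). For the noise term,
split the spectrum at α. On (0, α] both g_α and r_α g_α are comparable to 1/α; on (α, ∞) one has
g_α(t) ≤ 1/t, and the Muckenhoupt condition moves that part back to (0, α]. Hence the noise is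
dominated by the quasi-optimality functional of the noise itself (`exists_norm_filter_le`), and this
is at most ψ_ω(α, y^δ) + ψ_ω(α, y), with ω the weight being minimized.

Let s = θ⁻¹(δ) and σ = (ωφ)(s). Comparing a minimizer with the parameter s gives ψ_ω(α, y^δ) = O(σ),
because s balances ω(s)δ/√s against ω(s)φ(s) (`exists_psiKappa_argmin_le`). Conversely ψ_ω(α, y^δ) ≥
dα uniformly for small δ (`exists_le_psiKappa`), so every minimizer satisfies α = O(σ), and regular
variation turns κ(α)φ(α) into O((κφ)(σ)). The result is the rate (κφ)(σ) ∨ σ of `exists_rate`. An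
auxiliary b(α) with κ ≤ b(α)ω on (0, α] and b(α)ω(α) ≤ κ(α) allows the error weight κ and the
minimized weight ω to differ.

The three claims are the pairs (error weight, ω) = (1, 1), (κ, 1), (κ, κ); for f = κ(A)u the
functional error is at most ‖u‖ ‖κ(A)(x_α^δ - x)‖. Since spectral measures and the calculus are
chosen by `Classical.epsilon`, their existence and uniqueness have to be proved beforehand; the
calculus is built from strong limits of polynomials in A. -/

namespace FunctionalStrategy

/-! ### Existence of scalar spectral measures. -/

section ExistenceOfSpectralMeasure

variable {𝕜 H : Type*} [RCLike 𝕜] [NormedAddCommGroup H] [InnerProductSpace 𝕜 H]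

/-- Compression to a Krylov subspace: finitely many moments of a bounded positive operator are those
of a measure with finite support in `[0, ‖A‖]`. -/
lemma exists_finite_quadrature {A : H →L[𝕜] H} (hA : A.IsPositive) (v : H) (N : ℕ) :
    ∃ (n : ℕ) (w lam : Fin n → ℝ), (∀ i, 0 ≤ w i) ∧ (∀ i, lam i ∈ Icc 0 ‖A‖) ∧
      ∀ k ≤ N, ∑ i, w i * lam i ^ k = RCLike.re (inner 𝕜 v ((A ^ k) v)) := by
  classical
  let K : Submodule 𝕜 H :=
    Submodule.span 𝕜 (((Finset.range (N + 1)).image fun k => (A ^ k) v : Finset H) : Set H)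
  have : FiniteDimensional 𝕜 K := FiniteDimensional.span_finset 𝕜 _
  have hmem : ∀ k ≤ N, (A ^ k) v ∈ K := fun k hk => Submodule.subset_span <| by
    simp only [Finset.coe_image, Finset.coe_range, Set.mem_image, Set.mem_Iio]
    exact ⟨k, by omega, rfl⟩
  let B : K →ₗ[𝕜] K := ((K.orthogonalProjectionOnto ∘L A) ∘L K.subtypeL : K →L[𝕜] K)
  have hBapp : ∀ u : K, B u = K.orthogonalProjectionOnto (A u) := fun u => rfl
  have hB : B.IsSymmetric := by
    intro u w
    rw [hBapp, hBapp, Submodule.inner_orthogonalProjectionOnto_eq_of_mem_left,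
      Submodule.inner_orthogonalProjectionOnto_eq_of_mem_right]
    exact hA.isSymmetric u w
  let v0 : K := ⟨v, by simpa using hmem 0 (Nat.zero_le _)⟩
  -- Up to order N the iterates stay in the Krylov space, so the projection in the compression `B`
  -- does nothing to them.
  have hpow : ∀ k ≤ N, ((B ^ k) v0 : H) = (A ^ k) v := by
    intro k
    induction k with
    | zero => intro _; simp [v0]
    | succ k ih =>
      intro hk
      rw [pow_succ', Module.End.mul_apply, hBapp, ih (by omega)]
      have : A ((A ^ k) v) = (A ^ (k + 1)) v := by rw [pow_succ']; rfl
      rw [this]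
      exact Submodule.starProjection_eq_self_iff.2 (hmem _ hk)
  let b := hB.eigenvectorBasis (n := Module.finrank 𝕜 K) rfl
  -- Nodes are the eigenvalues of the compression, weights the squared coefficients of `v` in its
  -- eigenbasis.
  refine ⟨Module.finrank 𝕜 K, fun i => ‖inner 𝕜 (b i) v0‖ ^ 2, hB.eigenvalues rfl,
    fun i => by positivity, fun i => ?_, fun k hk => ?_⟩
  · have h1 : inner 𝕜 (b i) (B (b i)) = (hB.eigenvalues rfl i : 𝕜) := by
      simp only [b]
      rw [hB.apply_eigenvectorBasis, inner_smul_right]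
      simp
    have h2 : RCLike.re (inner 𝕜 (b i : H) (A (b i))) = hB.eigenvalues rfl i := by
      rw [hBapp, Submodule.inner_orthogonalProjectionOnto_eq_of_mem_left] at h1
      rw [h1]; simp
    have hn : ‖(b i : H)‖ = 1 := b.orthonormal.1 i
    constructor
    · rw [← h2]; exact hA.inner_nonneg_right _ |> fun h => (RCLike.nonneg_iff.1 h).1
    · rw [← h2]
      refine (RCLike.re_le_norm _).trans ((norm_inner_le_norm _ _).trans ?_)
      rw [hn, one_mul]
      simpa [hn] using A.le_opNorm (b i : H)
  · have hBk : ∀ k i, inner 𝕜 (b i) ((B ^ k) v0) = (hB.eigenvalues rfl i : 𝕜) ^ k * inner 𝕜 (b i) v0 := by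
      intro k i
      induction k with
      | zero => simp
      | succ k ih =>
        rw [pow_succ', Module.End.mul_apply, ← hB, hB.apply_eigenvectorBasis, inner_smul_left, ih,
          RCLike.conj_ofReal]
        ring
    have h3 : inner 𝕜 v ((A ^ k) v) = inner 𝕜 v0 ((B ^ k) v0) := by
      rw [← hpow k hk]; rfl
    rw [h3, ← b.sum_inner_mul_inner, map_sum]
    refine Finset.sum_congr rfl fun i _ => ?_
    rw [hBk, mul_left_comm, ← inner_conj_symm v0 (b i), RCLike.conj_mul, ← RCLike.ofReal_pow,
      ← RCLike.ofReal_pow, ← RCLike.ofReal_mul, RCLike.ofReal_re, mul_comm]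

/-- Weak compactness of the probability measures on [0, ‖A‖]: those with the correct moments up to
order N form a decreasing sequence of closed sets, nonempty by quadrature, and any common point has
all moments correct. The normalization makes the zeroth moment 1. -/
lemma exists_isSpectralMeasure_of_norm_one {A : H →L[𝕜] H} (hA : A.IsPositive) {v : H}
    (hv : ‖v‖ = 1) : ∃ μ, IsSpectralMeasure A v μ := by
  let I := Icc (0 : ℝ) ‖A‖
  let m : ℕ → BoundedContinuousFunction I ℝ := fun k =>
    BoundedContinuousFunction.mkOfCompact ⟨fun t : I => (t : ℝ) ^ k, by fun_prop⟩
  let S : ℕ → Set (ProbabilityMeasure I) := fun N =>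
    {P | ∀ k ≤ N, ∫ t, m k t ∂(P : Measure I) = RCLike.re (inner 𝕜 v ((A ^ k) v))}
  have hclosed : ∀ N, IsClosed (S N) := fun N => by
    simp only [S, Set.ofPred_forall]
    exact isClosed_iInter fun k => isClosed_iInter fun _ => isClosed_eq
      (ProbabilityMeasure.continuous_integral_boundedContinuousFunction _) continuous_const
  have hne : ∀ N, (S N).Nonempty := fun N => by
    obtain ⟨n, w, lam, hw, hlam, hmom⟩ := exists_finite_quadrature hA v N
    let P : Measure I := ∑ i, ENNReal.ofReal (w i) • Measure.dirac (⟨lam i, hlam i⟩ : I)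
    have hw1 : ∑ i, w i = 1 := by simpa [hv] using hmom 0 (Nat.zero_le _)
    have hP : IsProbabilityMeasure P := ⟨by
      simp only [P, Measure.coe_finsetSum, Finset.sum_apply, Measure.smul_apply, measure_univ,
        smul_eq_mul, mul_one]
      rw [← ENNReal.ofReal_sum_of_nonneg fun i _ => hw i, hw1, ENNReal.ofReal_one]⟩
    refine ⟨⟨P, hP⟩, fun k hk => ?_⟩
    rw [← hmom k hk]
    change ∫ t, m k t ∂P = _
    rw [integral_finsetSum_measure fun i _ =>
      ((m k).integrable _).smul_measure ENNReal.ofReal_ne_top]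
    refine Finset.sum_congr rfl fun i _ => ?_
    rw [integral_smul_measure, integral_dirac, ENNReal.toReal_ofReal (hw i)]
    rfl
  obtain ⟨P, hP⟩ := IsCompact.nonempty_iInter_of_sequence_nonempty_isCompact_isClosed S
    (fun N P hP k hk => hP k (by omega)) hne (hclosed 0).isCompact hclosed
  rw [mem_iInter] at hP
  refine ⟨(P : Measure I).map (↑), ⟨inferInstance, ?_, fun n => ?_⟩⟩
  · rw [Measure.map_apply measurable_subtype_coe measurableSet_Icc.compl]
    convert measure_empty (μ := (P : Measure I))
    ext t; simp
  · rw [integral_map measurable_subtype_coe.aemeasurable (by fun_prop)]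
    exact hP n n le_rfl

lemma exists_isSpectralMeasure {A : H →L[𝕜] H} (hA : A.IsPositive) (v : H) :
    ∃ μ, IsSpectralMeasure A v μ := by
  rcases eq_or_ne v 0 with rfl | hv
  · exact ⟨0, inferInstance, by simp, by simp⟩
  have hv' : ‖v‖ ≠ 0 := norm_ne_zero_iff.2 hv
  obtain ⟨μ, hfin, hsupp, hmom⟩ := exists_isSpectralMeasure_of_norm_one hA
    (v := ((‖v‖⁻¹ : ℝ) : 𝕜) • v) (by rw [norm_smul]; simp [hv'])
  refine ⟨ENNReal.ofReal (‖v‖ ^ 2) • μ, ?_, by simp [hsupp], fun n => ?_⟩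
  · exact Measure.smul_finite _ ENNReal.ofReal_ne_top
  · rw [integral_smul_measure, hmom, ENNReal.toReal_ofReal (by positivity), map_smul,
      inner_smul_left, inner_smul_right, RCLike.conj_ofReal, RCLike.re_ofReal_mul,
      RCLike.re_ofReal_mul, smul_eq_mul]
    field_simp

lemma isSpectralMeasure_spectralMeasure {A : H →L[𝕜] H} (hA : A.IsPositive) (v : H) :
    IsSpectralMeasure A v (spectralMeasure A v) :=
  Classical.epsilon_spec (exists_isSpectralMeasure hA v)

end ExistenceOfSpectralMeasure

/-! ### Determinacy of the moment problem on a compact interval. -/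

section Moments

/-- A finite measure on a compact interval is determined by its moments. -/
lemma measure_ext_of_moments {μ ν : Measure ℝ} [IsFiniteMeasure μ] [IsFiniteMeasure ν] {M : ℝ}
    (hμ : μ (Icc 0 M)ᶜ = 0) (hν : ν (Icc 0 M)ᶜ = 0)
    (h : ∀ n : ℕ, ∫ t, t ^ n ∂μ = ∫ t, t ^ n ∂ν) : μ = ν := by
  have hint : ∀ {ρ : Measure ℝ} [IsFiniteMeasure ρ], ρ (Icc 0 M)ᶜ = 0 → ∀ {f : ℝ → ℝ},
      Continuous f → Integrable f ρ := by
    intro ρ _ hρ f hf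
    rw [← Measure.restrict_eq_self_of_ae_mem (s := Icc 0 M) (μ := ρ) (by rwa [ae_iff])]
    exact hf.continuousOn.integrableOn_Icc
  have hpoly : ∀ p : Polynomial ℝ, ∫ t, p.eval t ∂μ = ∫ t, p.eval t ∂ν := by
    intro p
    induction p using Polynomial.induction_on' with
    | add p q hp hq =>
      simp only [Polynomial.eval_add]
      rw [integral_add (hint hμ p.continuous) (hint hμ q.continuous),
        integral_add (hint hν p.continuous) (hint hν q.continuous), hp, hq]
    | monomial n c =>
      simp only [Polynomial.eval_monomial, integral_const_mul, h]
  refine ext_of_forall_integral_eq_of_IsFiniteMeasure fun f => ?_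
  refine eq_of_forall_dist_le fun ε hε => ?_
  -- The summand 1 keeps `m` positive even if both measures vanish; Weierstrass approximation within
  -- ε/m then costs at most ε in total.
  set m := μ.real univ + ν.real univ + 1 with hm
  have hmpos : 0 < m := by positivity
  obtain ⟨p, hp⟩ := exists_polynomial_near_of_continuousOn 0 M f f.continuous.continuousOn (ε / m)
    (by positivity)
  have key : ∀ {ρ : Measure ℝ} [IsFiniteMeasure ρ], ρ (Icc 0 M)ᶜ = 0 →
      ‖∫ t, f t ∂ρ - ∫ t, p.eval t ∂ρ‖ ≤ ε / m * ρ.real univ := by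
    intro ρ _ hρ
    rw [← integral_sub (hint hρ f.continuous) (hint hρ p.continuous)]
    refine norm_integral_le_of_norm_le_const ?_
    filter_upwards [(ae_iff.2 hρ : ∀ᵐ t ∂ρ, t ∈ Icc 0 M)] with t ht
    rw [norm_sub_rev]
    exact (hp t ht).le
  have h1 := key hμ
  have h2 := key hν
  rw [hpoly] at h1
  rw [dist_eq_norm]
  calc ‖∫ t, f t ∂μ - ∫ t, f t ∂ν‖
      = ‖(∫ t, f t ∂μ - ∫ t, p.eval t ∂ν) - (∫ t, f t ∂ν - ∫ t, p.eval t ∂ν)‖ := by congr 1; ring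
    _ ≤ ε / m * μ.real univ + ε / m * ν.real univ := (norm_sub_le _ _).trans (add_le_add h1 h2)
    _ = ε / m * (m - 1) := by rw [hm]; ring
    _ ≤ ε / m * m := by gcongr; linarith
    _ = ε := by field_simp

end Moments

/-! ### Polynomial and bounded Borel functional calculus. -/

section PolynomialCalculus

variable {𝕜 H : Type*} [RCLike 𝕜] [NormedAddCommGroup H] [InnerProductSpace 𝕜 H]

/-- The operator `p(A)` for a real polynomial `p`. -/
noncomputable def polyOp (A : H →L[𝕜] H) : Polynomial ℝ →+* (H →L[𝕜] H) :=
  (Polynomial.aeval A : Polynomial 𝕜 →ₐ[𝕜] (H →L[𝕜] H)).toRingHom.comp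
    (Polynomial.mapRingHom (algebraMap ℝ 𝕜))

lemma polyOp_apply (A : H →L[𝕜] H) (p : Polynomial ℝ) :
    polyOp A p = Polynomial.aeval A (p.map (algebraMap ℝ 𝕜)) := rfl

lemma polyOp_monomial (A : H →L[𝕜] H) (n : ℕ) (c : ℝ) :
    polyOp A (Polynomial.monomial n c) = (c : 𝕜) • A ^ n := by
  rw [polyOp_apply, Polynomial.map_monomial, Polynomial.aeval_monomial, Algebra.algebraMap_eq_smul_one,
    smul_mul_assoc, one_mul]

lemma polyOp_X (A : H →L[𝕜] H) : polyOp A Polynomial.X = A := by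
  simp [polyOp_apply]

variable {A : H →L[𝕜] H}

lemma isSymmetric_pow (hA : A.IsPositive) (n : ℕ) (v w : H) :
    inner 𝕜 ((A ^ n) v) w = inner 𝕜 v ((A ^ n) w) := by
  induction n generalizing v w with
  | zero => simp
  | succ n ih =>
    have h1 : (A ^ (n + 1)) v = (A ^ n) (A v) := by rw [pow_succ]; rfl
    have h2 : (A ^ (n + 1)) w = A ((A ^ n) w) := by rw [pow_succ']; rfl
    rw [h1, h2, ih]
    exact hA.isSymmetric v ((A ^ n) w)

lemma isSymmetric_polyOp (hA : A.IsPositive) (p : Polynomial ℝ) (v w : H) :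
    inner 𝕜 (polyOp A p v) w = inner 𝕜 v (polyOp A p w) := by
  induction p using Polynomial.induction_on' with
  | add p q hp hq => simp [map_add, inner_add_left, inner_add_right, hp, hq]
  | monomial n c =>
    rw [polyOp_monomial, smul_apply, smul_apply, inner_smul_left, inner_smul_right,
      isSymmetric_pow hA, RCLike.conj_ofReal]

lemma isFiniteMeasure_spectralMeasure (hA : A.IsPositive) (v : H) :
    IsFiniteMeasure (spectralMeasure A v) :=
  (isSpectralMeasure_spectralMeasure hA v).1

lemma ae_mem_spectralMeasure (hA : A.IsPositive) (v : H) :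
    ∀ᵐ t ∂(spectralMeasure A v), t ∈ Icc 0 ‖A‖ :=
  ae_iff.2 (isSpectralMeasure_spectralMeasure hA v).2.1

/-- Moments determine the measure, so any measure satisfying the specification is the one picked by
`Classical.epsilon`. -/
lemma IsSpectralMeasure.eq (hA : A.IsPositive) {v : H} {μ : Measure ℝ}
    (hμ : IsSpectralMeasure A v μ) : spectralMeasure A v = μ := by
  have h := isSpectralMeasure_spectralMeasure hA v
  have := h.1
  have := hμ.1
  exact measure_ext_of_moments h.2.1 hμ.2.1 fun n => (h.2.2 n).trans (hμ.2.2 n).symm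

lemma integrable_spectralMeasure_of_continuous (hA : A.IsPositive) (v : H) {f : ℝ → ℝ}
    (hf : Continuous f) : Integrable f (spectralMeasure A v) := by
  have := isFiniteMeasure_spectralMeasure hA v
  rw [← Measure.restrict_eq_self_of_ae_mem (ae_mem_spectralMeasure hA v)]
  exact hf.continuousOn.integrableOn_Icc

lemma inner_polyOp (hA : A.IsPositive) (p : Polynomial ℝ) (v : H) :
    RCLike.re (inner 𝕜 v (polyOp A p v)) = ∫ t, p.eval t ∂(spectralMeasure A v) := by
  induction p using Polynomial.induction_on' with
  | add p q hp hq =>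
    simp only [map_add, add_apply, inner_add_right, hp, hq, Polynomial.eval_add]
    rw [integral_add (integrable_spectralMeasure_of_continuous hA v p.continuous)
      (integrable_spectralMeasure_of_continuous hA v q.continuous)]
  | monomial n c =>
    simp only [Polynomial.eval_monomial, integral_const_mul,
      (isSpectralMeasure_spectralMeasure hA v).2.2 n, polyOp_monomial]
    rw [smul_apply, inner_smul_right, RCLike.re_ofReal_mul]

lemma norm_polyOp_sq (hA : A.IsPositive) (p : Polynomial ℝ) (v : H) :
    ‖polyOp A p v‖ ^ 2 = ∫ t, p.eval t ^ 2 ∂(spectralMeasure A v) := by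
  have h : ∀ t, p.eval t ^ 2 = (p * p).eval t := fun t => by rw [Polynomial.eval_mul, sq]
  simp_rw [h]
  rw [← inner_polyOp hA, map_mul, mul_apply_eq_comp, ← isSymmetric_polyOp hA,
    inner_self_eq_norm_sq_to_K, ← RCLike.ofReal_pow, RCLike.ofReal_re]

lemma spectralMeasure_real_univ (hA : A.IsPositive) (v : H) :
    (spectralMeasure A v).real univ = ‖v‖ ^ 2 := by
  have := (isSpectralMeasure_spectralMeasure hA v).2.2 0
  simpa using this

/-- Parallelogram law for v = w + (v - w) and 2w - v = w - (v - w): the measures at v and 2w - v add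
up to the right-hand side, as their moments show. -/
lemma spectralMeasure_le (hA : A.IsPositive) (v w : H) :
    spectralMeasure A v ≤ (2 : ENNReal) • (spectralMeasure A w + spectralMeasure A (v - w)) := by
  have hv := isSpectralMeasure_spectralMeasure hA v
  have hw := isSpectralMeasure_spectralMeasure hA w
  have hd := isSpectralMeasure_spectralMeasure hA (v - w)
  have he := isSpectralMeasure_spectralMeasure hA (w + w - v)
  have := hv.1
  have := hw.1
  have := hd.1
  have := he.1
  have hint := fun u n => integrable_spectralMeasure_of_continuous hA u (continuous_pow n)
  have key : spectralMeasure A v + spectralMeasure A (w + w - v)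
      = (2 : ENNReal) • (spectralMeasure A w + spectralMeasure A (v - w)) := by
    have : IsFiniteMeasure ((2 : ENNReal) • (spectralMeasure A w + spectralMeasure A (v - w))) :=
      Measure.smul_finite _ (by simp)
    refine measure_ext_of_moments (M := ‖A‖) ?_ ?_ fun n => ?_
    · simp [hv.2.1, he.2.1]
    · simp [hw.2.1, hd.2.1]
    · rw [integral_add_measure (hint _ _) (hint _ _), integral_smul_measure,
        integral_add_measure (hint _ _) (hint _ _), hv.2.2, he.2.2, hw.2.2, hd.2.2]
      simp only [map_sub, map_add, inner_sub_left, inner_sub_right, inner_add_left,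
        inner_add_right, ENNReal.toReal_ofNat, smul_eq_mul]
      have : RCLike.re (inner 𝕜 w ((A ^ n) v)) = RCLike.re (inner 𝕜 v ((A ^ n) w)) := by
        rw [← isSymmetric_pow hA, ← inner_conj_symm, RCLike.conj_re]
      linarith
  rw [← key]
  exact Measure.le_add_right le_rfl

/-- The polynomials `p n` are uniformly bounded on `[0, ‖A‖]` and converge to `h` almost everywhere
with respect to every scalar spectral measure of `A`. -/
structure PolyLimit (A : H →L[𝕜] H) (h : ℝ → ℝ) (p : ℕ → Polynomial ℝ) : Prop where
  bound : ∃ C, ∀ n, ∀ t ∈ Icc 0 ‖A‖, |(p n).eval t| ≤ C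
  tendsto : ∀ v, ∀ᵐ t ∂(spectralMeasure A v), Tendsto (fun n => (p n).eval t) atTop (𝓝 (h t))

namespace PolyLimit

variable {h k : ℝ → ℝ} {p q : ℕ → Polynomial ℝ}

lemma const (A : H →L[𝕜] H) (p : Polynomial ℝ) : PolyLimit A (fun t => p.eval t) fun _ => p where
  bound := by
    obtain ⟨C, hC⟩ := isCompact_Icc.exists_bound_of_continuousOn
      (s := Icc 0 ‖A‖) (f := fun t => p.eval t) p.continuous.continuousOn
    exact ⟨C, fun _ t ht => hC t ht⟩
  tendsto v := .of_forall fun t => tendsto_const_nhds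

lemma add (hp : PolyLimit A h p) (hq : PolyLimit A k q) :
    PolyLimit A (fun t => h t + k t) fun n => p n + q n where
  bound := by
    obtain ⟨C, hC⟩ := hp.bound
    obtain ⟨D, hD⟩ := hq.bound
    refine ⟨C + D, fun n t ht => ?_⟩
    rw [Polynomial.eval_add]
    exact (abs_add_le _ _).trans (add_le_add (hC n t ht) (hD n t ht))
  tendsto v := by
    filter_upwards [hp.tendsto v, hq.tendsto v] with t h1 h2
    simpa only [Polynomial.eval_add] using h1.add h2

lemma mul (hp : PolyLimit A h p) (hq : PolyLimit A k q) :
    PolyLimit A (fun t => h t * k t) fun n => p n * q n where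
  bound := by
    obtain ⟨C, hC⟩ := hp.bound
    obtain ⟨D, hD⟩ := hq.bound
    refine ⟨C * D, fun n t ht => ?_⟩
    rw [Polynomial.eval_mul, abs_mul]
    exact mul_le_mul (hC n t ht) (hD n t ht) (abs_nonneg _) ((abs_nonneg _).trans (hC n t ht))
  tendsto v := by
    filter_upwards [hp.tendsto v, hq.tendsto v] with t h1 h2
    simpa only [Polynomial.eval_mul] using h1.mul h2

lemma tendsto_integral (hA : A.IsPositive) (hp : PolyLimit A h p) (v : H) :
    Tendsto (fun n => ∫ t, (p n).eval t ∂(spectralMeasure A v)) atTop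
      (𝓝 (∫ t, h t ∂(spectralMeasure A v))) := by
  obtain ⟨C, hC⟩ := hp.bound
  have := isFiniteMeasure_spectralMeasure hA v
  refine tendsto_integral_of_dominated_convergence (fun _ => C)
    (fun n => (p n).continuous.aestronglyMeasurable) (integrable_const C) (fun n => ?_)
    (hp.tendsto v)
  filter_upwards [ae_mem_spectralMeasure hA v] with t ht using hC n t ht

lemma integrable (hA : A.IsPositive) (hp : PolyLimit A h p) (v : H) :
    Integrable h (spectralMeasure A v) := by
  obtain ⟨C, hC⟩ := hp.bound
  have := isFiniteMeasure_spectralMeasure hA v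
  refine Integrable.of_bound (C := C) (aestronglyMeasurable_of_tendsto_ae atTop
    (fun n => (p n).continuous.aestronglyMeasurable) (hp.tendsto v)) ?_
  filter_upwards [ae_mem_spectralMeasure hA v, hp.tendsto v] with t ht h1
  exact le_of_tendsto h1.norm (.of_forall fun n => hC n t ht)

/-- The squared distance of two terms is the integral of (p_m - p_n)² against the spectral measure,
which tends to 0 by dominated convergence. -/
lemma cauchySeq (hA : A.IsPositive) (hp : PolyLimit A h p) (v : H) :
    CauchySeq fun n => polyOp A (p n) v := by
  obtain ⟨C, hC⟩ := hp.bound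
  have := isFiniteMeasure_spectralMeasure hA v
  have key : Tendsto (fun m : ℕ × ℕ => ∫ t, (p m.1 - p m.2).eval t ^ 2 ∂(spectralMeasure A v))
      atTop (𝓝 (∫ _, (0 : ℝ) ∂(spectralMeasure A v))) := by
    refine tendsto_integral_filter_of_dominated_convergence (fun _ => (C + C) ^ 2)
      (.of_forall fun m => ((p m.1 - p m.2).continuous.pow 2).aestronglyMeasurable)
      (.of_forall fun m => ?_) (integrable_const _) ?_
    · filter_upwards [ae_mem_spectralMeasure hA v] with t ht
      rw [Polynomial.eval_sub, norm_pow]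
      gcongr
      exact (norm_sub_le _ _).trans (add_le_add (hC _ t ht) (hC _ t ht))
    · filter_upwards [hp.tendsto v] with t ht
      rw [← prod_atTop_atTop_eq]
      have := ((ht.comp tendsto_fst).sub (ht.comp tendsto_snd)).pow 2
      simpa [Function.comp_def] using this
  simp only [← norm_polyOp_sq hA, integral_zero] at key
  have key2 : Tendsto (fun m : ℕ × ℕ => ‖polyOp A (p m.1 - p m.2) v‖) atTop (𝓝 0) := by
    have := (Real.continuous_sqrt.tendsto 0).comp key
    simpa [Function.comp_def, Real.sqrt_sq] using this
  rw [cauchySeq_iff_tendsto_dist_atTop_0]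
  simpa [dist_eq_norm] using key2

variable [CompleteSpace H]

lemma exists_isFunctionOf (hA : A.IsPositive) (hp : PolyLimit A h p) :
    ∃ B : H →L[𝕜] H, IsFunctionOf A h B ∧
      ∀ v, Tendsto (fun n => polyOp A (p n) v) atTop (𝓝 (B v)) := by
  choose b hb using fun v => cauchySeq_tendsto_of_complete (hp.cauchySeq hA v)
  let B : H →L[𝕜] H := continuousLinearMapOfTendsto (fun n => polyOp A (p n)) (f := b)
    (tendsto_pi_nhds.2 hb)
  have hB : ∀ v, Tendsto (fun n => polyOp A (p n) v) atTop (𝓝 (B v)) := hb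
  refine ⟨B, ⟨?_, fun v => ?_⟩, hB⟩
  · rw [ContinuousLinearMap.isSelfAdjoint_iff_isSymmetric]
    intro v w
    refine tendsto_nhds_unique ((hB v).inner tendsto_const_nhds)
      (Tendsto.congr (fun n => ?_) (tendsto_const_nhds.inner (hB w)))
    exact (isSymmetric_polyOp hA (p n) v w).symm
  · refine tendsto_nhds_unique ((RCLike.continuous_re.tendsto _).comp
      ((tendsto_const_nhds (x := v)).inner (hB v))) ((hp.tendsto_integral hA v).congr fun n => ?_)
    rw [← inner_polyOp hA, Function.comp_apply]

end PolyLimit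

/-- A symmetric operator with vanishing quadratic form is zero, over the reals as well as over ℂ. -/
lemma IsFunctionOf.eq [CompleteSpace H] {h : ℝ → ℝ} {B C : H →L[𝕜] H} (hB : IsFunctionOf A h B)
    (hC : IsFunctionOf A h C) : B = C := by
  have hs : (B - C).IsSymmetric :=
    (ContinuousLinearMap.isSelfAdjoint_iff_isSymmetric).1 (hB.1.sub hC.1)
  have h0 : ((B - C : H →L[𝕜] H) : H →ₗ[𝕜] H) = 0 := by
    rw [← hs.inner_map_self_eq_zero]
    intro v
    have h1 := hs.coe_re_inner_self_apply v
    rw [hs, ← h1, ContinuousLinearMap.coe_coe, sub_apply,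
      inner_sub_right, map_sub, hB.2, hC.2]
    simp
  ext v
  have := LinearMap.congr_fun h0 v
  simpa [sub_eq_zero] using this

lemma PolyLimit.tendsto_funCalc [CompleteSpace H] (hA : A.IsPositive) {h : ℝ → ℝ}
    {p : ℕ → Polynomial ℝ} (hp : PolyLimit A h p) (v : H) :
    Tendsto (fun n => polyOp A (p n) v) atTop (𝓝 (funCalc A h v)) := by
  obtain ⟨B, hB, hlim⟩ := hp.exists_isFunctionOf hA
  have : funCalc A h = B := (Classical.epsilon_spec ⟨B, hB⟩ : IsFunctionOf A h (funCalc A h)).eq hB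
  rw [this]
  exact hlim v

/-- Bounded Borel functions that are limits of polynomials on the spectrum of `A`. -/
def Admissible (A : H →L[𝕜] H) (h : ℝ → ℝ) : Prop := ∃ p, PolyLimit A h p

namespace Admissible

variable {h k : ℝ → ℝ}

lemma poly (A : H →L[𝕜] H) (p : Polynomial ℝ) : Admissible A fun t => p.eval t :=
  ⟨_, PolyLimit.const A p⟩

lemma id (A : H →L[𝕜] H) : Admissible A fun t => t := by
  simpa using Admissible.poly A Polynomial.X

lemma const (A : H →L[𝕜] H) (c : ℝ) : Admissible A fun _ => c := by
  simpa using Admissible.poly A (Polynomial.C c)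

lemma add (hh : Admissible A h) (hk : Admissible A k) : Admissible A fun t => h t + k t := by
  obtain ⟨p, hp⟩ := hh
  obtain ⟨q, hq⟩ := hk
  exact ⟨_, hp.add hq⟩

lemma mul (hh : Admissible A h) (hk : Admissible A k) : Admissible A fun t => h t * k t := by
  obtain ⟨p, hp⟩ := hh
  obtain ⟨q, hq⟩ := hk
  exact ⟨_, hp.mul hq⟩

lemma sub (hh : Admissible A h) (hk : Admissible A k) : Admissible A fun t => h t - k t := by
  convert hh.add ((const A (-1)).mul hk) using 2
  ring

lemma pow_two (hh : Admissible A h) : Admissible A fun t => h t ^ 2 := by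
  simpa only [sq] using hh.mul hh

lemma integrable (hA : A.IsPositive) (hh : Admissible A h) (v : H) :
    Integrable h (spectralMeasure A v) := hh.choose_spec.integrable hA v

end Admissible

section FunctionalCalculus

variable [CompleteSpace H] {h k : ℝ → ℝ}

lemma funCalc_poly (hA : A.IsPositive) (p : Polynomial ℝ) :
    funCalc A (fun t => p.eval t) = polyOp A p := by
  ext v
  exact tendsto_nhds_unique ((PolyLimit.const A p).tendsto_funCalc hA v) tendsto_const_nhds

lemma funCalc_id (hA : A.IsPositive) : funCalc A (fun t => t) = A := by
  simpa [polyOp_X] using funCalc_poly hA Polynomial.X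

lemma funCalc_one (hA : A.IsPositive) : funCalc A (fun _ => 1) = 1 := by
  simpa using funCalc_poly hA 1

lemma funCalc_add (hA : A.IsPositive) (hh : Admissible A h) (hk : Admissible A k) (v : H) :
    funCalc A (fun t => h t + k t) v = funCalc A h v + funCalc A k v := by
  obtain ⟨p, hp⟩ := hh
  obtain ⟨q, hq⟩ := hk
  refine tendsto_nhds_unique ((hp.add hq).tendsto_funCalc hA v)
    (((hp.tendsto_funCalc hA v).add (hq.tendsto_funCalc hA v)).congr fun n => ?_)
  simp

lemma inner_funCalc (hA : A.IsPositive) (hh : Admissible A h) (v w : H) :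
    inner 𝕜 (funCalc A h v) w = inner 𝕜 v (funCalc A h w) := by
  obtain ⟨p, hp⟩ := hh
  refine tendsto_nhds_unique ((hp.tendsto_funCalc hA v).inner tendsto_const_nhds)
    ((tendsto_const_nhds.inner (hp.tendsto_funCalc hA w)).congr fun n => ?_)
  exact (isSymmetric_polyOp hA (p n) v w).symm

lemma norm_funCalc_sq (hA : A.IsPositive) (hh : Admissible A h) (v : H) :
    ‖funCalc A h v‖ ^ 2 = ∫ t, h t ^ 2 ∂(spectralMeasure A v) := by
  obtain ⟨p, hp⟩ := hh
  refine tendsto_nhds_unique ((hp.tendsto_funCalc hA v).norm.pow 2) ?_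
  have := (hp.mul hp).tendsto_integral hA v
  simp only [← sq, Polynomial.eval_pow] at this
  exact this.congr fun n => (norm_polyOp_sq hA (p n) v).symm

/-- Tested against `w`, one polynomial factor moves to the other side of the inner product, so that
only strong convergence of each factor separately is needed. -/
lemma funCalc_mul (hA : A.IsPositive) (hh : Admissible A h) (hk : Admissible A k) (v : H) :
    funCalc A (fun t => h t * k t) v = funCalc A h (funCalc A k v) := by
  refine ext_inner_left 𝕜 fun w => ?_
  rw [← inner_funCalc hA hh]
  obtain ⟨p, hp⟩ := hh
  obtain ⟨q, hq⟩ := hk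
  refine tendsto_nhds_unique (tendsto_const_nhds.inner ((hp.mul hq).tendsto_funCalc hA v))
    (((hp.tendsto_funCalc hA w).inner (hq.tendsto_funCalc hA v)).congr fun n => ?_)
  rw [isSymmetric_polyOp hA, map_mul]
  rfl

lemma funCalc_sub (hA : A.IsPositive) (hh : Admissible A h) (hk : Admissible A k) (v : H) :
    funCalc A (fun t => h t - k t) v = funCalc A h v - funCalc A k v := by
  rw [eq_sub_iff_add_eq, ← funCalc_add hA (hh.sub hk) hk]
  simp

/-- An injective positive operator has no spectral mass at `0`. -/
lemma spectralMeasure_singleton_zero (hA : A.IsPositive) (hinj : Function.Injective A)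
    (v : H) : spectralMeasure A v {0} = 0 := by
  have hM : 0 < ‖A‖ + 1 := by positivity
  -- On [0, ‖A‖] these powers decrease to the indicator of {0}. As t times this indicator is 0, the
  -- operator `A` annihilates the corresponding spectral projection, and injectivity forces the
  -- projection to vanish.
  let p : ℕ → Polynomial ℝ := fun n => (1 - Polynomial.C (‖A‖ + 1)⁻¹ * Polynomial.X) ^ n
  have hev : ∀ n t, (p n).eval t = (1 - (‖A‖ + 1)⁻¹ * t) ^ n := fun n t => by simp [p]
  have hrange : ∀ t ∈ Icc 0 ‖A‖, 0 ≤ 1 - (‖A‖ + 1)⁻¹ * t ∧ 1 - (‖A‖ + 1)⁻¹ * t ≤ 1 := by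
    intro t ht
    have h1 : (‖A‖ + 1)⁻¹ * t ≤ 1 := by
      rw [inv_mul_le_iff₀ hM]; linarith [ht.2]
    have h2 : 0 ≤ (‖A‖ + 1)⁻¹ * t := mul_nonneg (inv_nonneg.2 hM.le) ht.1
    constructor <;> linarith
  have hp : PolyLimit A (({0} : Set ℝ).indicator 1) p := by
    refine ⟨⟨1, fun n t ht => ?_⟩, fun w => ?_⟩
    · rw [hev, abs_of_nonneg (pow_nonneg (hrange t ht).1 n)]
      exact pow_le_one₀ (hrange t ht).1 (hrange t ht).2
    · filter_upwards [ae_mem_spectralMeasure hA w] with t ht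
      simp only [hev]
      rcases ht.1.eq_or_lt with rfl | h0
      · simp
      · rw [indicator_of_notMem (by simpa using h0.ne')]
        refine tendsto_pow_atTop_nhds_zero_of_lt_one (hrange t ht).1 ?_
        have : 0 < (‖A‖ + 1)⁻¹ * t := mul_pos (inv_pos.2 hM) h0
        linarith
  have had : Admissible A (({0} : Set ℝ).indicator 1) := ⟨p, hp⟩
  have hz : (fun t : ℝ => t * ({0} : Set ℝ).indicator 1 t) = fun _ => 0 := by
    ext t
    by_cases ht : t = 0 <;> simp [ht]
  have h1 := funCalc_mul hA (.id A) had v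
  rw [hz, funCalc_id hA] at h1
  have h2 : funCalc A (fun _ => (0 : ℝ)) v = 0 := by
    have := norm_funCalc_sq hA (.const A 0) v
    simpa using this
  rw [h2] at h1
  have h3 : funCalc A (({0} : Set ℝ).indicator 1) v = 0 := hinj (by rw [← h1, map_zero])
  have h4 := norm_funCalc_sq hA had v
  have h5 : (fun t : ℝ => ({0} : Set ℝ).indicator (1 : ℝ → ℝ) t ^ 2) = ({0} : Set ℝ).indicator 1 := by
    ext t
    by_cases ht : t = 0 <;> simp [ht]
  rw [h3, h5, integral_indicator_one (measurableSet_singleton _)] at h4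
  have := isFiniteMeasure_spectralMeasure hA v
  rw [norm_zero, eq_comm] at h4
  simpa [measureReal_eq_zero_iff] using h4

lemma ae_pos_spectralMeasure (hA : A.IsPositive) (hinj : Function.Injective A) (v : H) :
    ∀ᵐ t ∂(spectralMeasure A v), t ∈ Ioc 0 ‖A‖ := by
  have h0 : ∀ᵐ t ∂(spectralMeasure A v), t ≠ 0 :=
    ae_iff.2 (by simpa using spectralMeasure_singleton_zero hA hinj v)
  filter_upwards [ae_mem_spectralMeasure hA v, h0] with t ht ht0
  exact ⟨lt_of_le_of_ne ht.1 ht0.symm, ht.2⟩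

/-- Functions that are continuous on `(0, ∞)` and bounded near `0` are admissible. -/
lemma admissible_of_continuousOn (hA : A.IsPositive) (hinj : Function.Injective A)
    (hc : ContinuousOn h (Ioi 0)) (hb : ∃ r > 0, ∃ C, ∀ t ∈ Ioc 0 r, |h t| ≤ C) :
    Admissible A h := by
  obtain ⟨r, hr, C, hC⟩ := hb
  have hpos : ∀ n : ℕ, (0 : ℝ) < 1 / (n + 1) := fun _ => Nat.one_div_pos_of_nat
  have hcn : ∀ n : ℕ, ContinuousOn (fun t => h (max t (1 / (n + 1)))) (Icc 0 ‖A‖) := fun n =>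
    hc.comp (by fun_prop) fun t _ => (hpos n).trans_le (le_max_right _ _)
  -- Freezing `h` below 1/(n+1) makes it continuous on [0, ‖A‖]; for fixed t > 0 the truncation is
  -- eventually inactive, and 0 carries no mass. Its argument can be as large as 1 even when ‖A‖ <
  -- 1, hence the interval [r, max ‖A‖ 1] below.
  choose p hp using fun n : ℕ => exists_polynomial_near_of_continuousOn 0 ‖A‖ _ (hcn n) _ (hpos n)
  obtain ⟨D, hD⟩ := (isCompact_Icc (a := r) (b := max ‖A‖ 1)).exists_bound_of_continuousOn
    (hc.mono fun t ht => hr.trans_le ht.1)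
  refine ⟨p, ⟨max C D + 1, fun n t ht => ?_⟩, fun v => ?_⟩
  · set s := max t (1 / ((n : ℝ) + 1)) with hs
    have h1 : |h s| ≤ max C D := by
      rcases le_total s r with hsr | hsr
      · exact (hC s ⟨(hpos n).trans_le (le_max_right _ _), hsr⟩).trans (le_max_left _ _)
      · refine (hD s ⟨hsr, max_le_max ht.2 ?_⟩).trans (le_max_right _ _)
        rw [div_le_one (by positivity)]
        linarith [n.cast_nonneg (α := ℝ)]
    have h2 := (hp n t ht).le
    have h3 : 1 / ((n : ℝ) + 1) ≤ 1 := by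
      rw [div_le_one (by positivity)]
      linarith [n.cast_nonneg (α := ℝ)]
    calc |(p n).eval t| = |((p n).eval t - h s) + h s| := by congr 1; ring
      _ ≤ 1 + max C D := (abs_add_le _ _).trans (add_le_add (h2.trans h3) h1)
      _ = _ := add_comm _ _
  · filter_upwards [ae_pos_spectralMeasure hA hinj v] with t ht
    have hz : Tendsto (fun n : ℕ => 1 / ((n : ℝ) + 1)) atTop (𝓝 0) :=
      tendsto_one_div_add_atTop_nhds_zero_nat
    rw [tendsto_iff_dist_tendsto_zero]
    refine squeeze_zero' (.of_forall fun n => dist_nonneg) ?_ hz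
    filter_upwards [hz.eventually_lt_const ht.1] with n hn
    have := hp n t ⟨ht.1.le, ht.2⟩
    rw [max_eq_left hn.le] at this
    exact this.le

end FunctionalCalculus

end PolynomialCalculus

/-! ### Transfer of spectral measures between T*T and TT*. -/

section Adjoint

variable {𝕜 X Y : Type*} [RCLike 𝕜]
  [NormedAddCommGroup X] [InnerProductSpace 𝕜 X] [CompleteSpace X]
  [NormedAddCommGroup Y] [InnerProductSpace 𝕜 Y] [CompleteSpace Y]

lemma isPositive_TstarT (T : X →L[𝕜] Y) : (TstarT T).IsPositive :=
  ContinuousLinearMap.isPositive_adjoint_comp_self T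

lemma isPositive_TTstar (T : X →L[𝕜] Y) : (TTstar T).IsPositive :=
  ContinuousLinearMap.isPositive_self_comp_adjoint T

lemma injective_TstarT {T : X →L[𝕜] Y} (hT : Function.Injective T) :
    Function.Injective (TstarT T) := by
  rw [injective_iff_map_eq_zero]
  intro x hx
  have h : inner 𝕜 (T x) (T x) = 0 := by
    rw [← ContinuousLinearMap.adjoint_inner_right]
    have : ContinuousLinearMap.adjoint T (T x) = 0 := hx
    rw [this, inner_zero_right]
  exact hT (by rw [inner_self_eq_zero.1 h, map_zero])

lemma norm_TstarT (T : X →L[𝕜] Y) : ‖TstarT T‖ = ‖T‖ * ‖T‖ :=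
  ContinuousLinearMap.norm_adjoint_comp_self T

lemma norm_TTstar (T : X →L[𝕜] Y) : ‖TTstar T‖ = ‖T‖ * ‖T‖ := by
  have := ContinuousLinearMap.norm_adjoint_comp_self (ContinuousLinearMap.adjoint T)
  rw [ContinuousLinearMap.adjoint_adjoint, LinearIsometryEquiv.norm_map] at this
  exact this

lemma adjoint_TTstar_pow (T : X →L[𝕜] Y) (n : ℕ) (z : Y) :
    ContinuousLinearMap.adjoint T ((TTstar T ^ n) z)
      = (TstarT T ^ n) (ContinuousLinearMap.adjoint T z) := by
  induction n generalizing z with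
  | zero => simp
  | succ n ih =>
    have h1 : (TTstar T ^ (n + 1)) z = (TTstar T ^ n) (TTstar T z) := by rw [pow_succ]; rfl
    have h2 : (TstarT T ^ (n + 1)) (ContinuousLinearMap.adjoint T z)
        = (TstarT T ^ n) (TstarT T (ContinuousLinearMap.adjoint T z)) := by rw [pow_succ]; rfl
    rw [h1, h2, ih]
    rfl

/-- `d‖E_t T* z‖² = t d‖F_t z‖²`. -/
lemma spectralMeasure_adjoint (T : X →L[𝕜] Y) (z : Y) :
    spectralMeasure (TstarT T) (ContinuousLinearMap.adjoint T z)
      = (spectralMeasure (TTstar T) z).withDensity fun t => ENNReal.ofReal t := by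
  have hν := isSpectralMeasure_spectralMeasure (isPositive_TTstar T) z
  have hmem := ae_mem_spectralMeasure (isPositive_TTstar T) z
  have hae : ∀ᵐ t ∂(spectralMeasure (TTstar T) z), (ENNReal.ofReal t).toReal = t := by
    filter_upwards [hmem] with t ht using ENNReal.toReal_ofReal ht.1
  refine IsSpectralMeasure.eq (isPositive_TstarT T) ⟨?_, ?_, fun n => ?_⟩
  · exact isFiniteMeasure_withDensity_ofReal
      (integrable_spectralMeasure_of_continuous (isPositive_TTstar T) z continuous_id).2
  · rw [norm_TstarT, ← norm_TTstar]
    exact withDensity_absolutelyContinuous _ _ hν.2.1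
  · rw [integral_withDensity_eq_integral_toReal_smul (by fun_prop) (.of_forall fun t => by simp)]
    have h1 : ∫ t, (ENNReal.ofReal t).toReal • t ^ n ∂(spectralMeasure (TTstar T) z)
        = ∫ t, t ^ (n + 1) ∂(spectralMeasure (TTstar T) z) := by
      refine integral_congr_ae ?_
      filter_upwards [hae] with t ht
      rw [ht, smul_eq_mul, pow_succ']
    rw [h1, hν.2.2, ← adjoint_TTstar_pow, ContinuousLinearMap.adjoint_inner_left, pow_succ']
    rfl

lemma setIntegral_spectralMeasure_adjoint (T : X →L[𝕜] Y) (z : Y) (h : ℝ → ℝ) {s : Set ℝ}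
    (hs : MeasurableSet s) :
    ∫ t in s, h t ∂(spectralMeasure (TstarT T) (ContinuousLinearMap.adjoint T z))
      = ∫ t in s, t * h t ∂(spectralMeasure (TTstar T) z) := by
  rw [spectralMeasure_adjoint, restrict_withDensity hs,
    integral_withDensity_eq_integral_toReal_smul (by fun_prop) (.of_forall fun t => by simp)]
  refine integral_congr_ae ?_
  filter_upwards [ae_restrict_of_ae (ae_mem_spectralMeasure (isPositive_TTstar T) z)] with t ht
  rw [ENNReal.toReal_ofReal ht.1, smul_eq_mul]

lemma integral_spectralMeasure_adjoint (T : X →L[𝕜] Y) (z : Y) (h : ℝ → ℝ) :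
    ∫ t, h t ∂(spectralMeasure (TstarT T) (ContinuousLinearMap.adjoint T z))
      = ∫ t, t * h t ∂(spectralMeasure (TTstar T) z) := by
  simpa using setIntegral_spectralMeasure_adjoint T z h MeasurableSet.univ

end Adjoint

/-! ### Norm bounds and admissibility of index functions. -/

section FunctionalCalculusBounds

variable {𝕜 H : Type*} [RCLike 𝕜] [NormedAddCommGroup H] [InnerProductSpace 𝕜 H] [CompleteSpace H]
  {A : H →L[𝕜] H}

lemma norm_funCalc_le (hA : A.IsPositive) (hinj : Function.Injective A) {h : ℝ → ℝ}
    (hh : Admissible A h) {C : ℝ} (hC0 : 0 ≤ C) (hC : ∀ t > 0, |h t| ≤ C) (v : H) :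
    ‖funCalc A h v‖ ≤ C * ‖v‖ := by
  have := isFiniteMeasure_spectralMeasure hA v
  refine abs_le_of_sq_le_sq' ?_ (by positivity) |>.2
  rw [norm_funCalc_sq hA hh, mul_pow, ← spectralMeasure_real_univ hA v]
  refine (integral_mono_ae (hh.pow_two.integrable hA v) (integrable_const (C ^ 2)) ?_).trans ?_
  · filter_upwards [ae_pos_spectralMeasure hA hinj v] with t ht
    exact sq_le_sq' (abs_le.1 (hC t ht.1)).1 (abs_le.1 (hC t ht.1)).2
  · simp [mul_comm]

lemma IsIndexFunction.admissible (hA : A.IsPositive) (hinj : Function.Injective A) {φ : ℝ → ℝ}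
    (hφ : IsIndexFunction φ) : Admissible A φ :=
  admissible_of_continuousOn hA hinj hφ.continuousOn ⟨1, one_pos, φ 1, fun t ht => by
    rw [abs_of_nonneg (hφ.nonneg t ht.1)]
    exact hφ.monotoneOn ht.1 (mem_Ioi.2 one_pos) ht.2⟩

end FunctionalCalculusBounds

/-! ### Pointwise consequences of the structural conditions. -/

section Filters

variable {𝕜 X Y : Type*} [RCLike 𝕜]
  [NormedAddCommGroup X] [InnerProductSpace 𝕜 X] [NormedAddCommGroup Y] [InnerProductSpace 𝕜 Y]
  {T : X →L[𝕜] Y} {g : ℝ → ℝ → ℝ} {φ κ : ℝ → ℝ}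

lemma continuousOn_filter (hg : ContinuousOn (fun p : ℝ × ℝ => g p.1 p.2) (Ioi 0 ×ˢ Ioi 0))
    {α : ℝ} (hα : 0 < α) : ContinuousOn (g α) (Ioi 0) :=
  hg.comp (f := fun t => (α, t)) (by fun_prop) fun t ht => ⟨hα, ht⟩

/-- The filter function `(1 - t g_α(t)) g_α(t)` of the quasi-optimality functional. -/
def qoFilter (g : ℝ → ℝ → ℝ) (α t : ℝ) : ℝ := (1 - t * g α t) * g α t

namespace StructuralAssumption

lemma filter_nonneg (hA : StructuralAssumption T g φ κ) {α t : ℝ} (hα : 0 < α) (ht : 0 < t) :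
    0 ≤ g α t :=
  nonneg_of_mul_nonneg_right (hA.filter_range α hα t ht).1 ht

lemma residual_nonneg (hA : StructuralAssumption T g φ κ) {α t : ℝ} (hα : 0 < α) (ht : 0 < t) :
    0 ≤ 1 - t * g α t := sub_nonneg.2 (hA.filter_range α hα t ht).2

lemma residual_le_one (hA : StructuralAssumption T g φ κ) {α t : ℝ} (hα : 0 < α) (ht : 0 < t) :
    1 - t * g α t ≤ 1 := sub_le_self _ (hA.filter_range α hα t ht).1

lemma filter_le_inv (hA : StructuralAssumption T g φ κ) {α t : ℝ} (hα : 0 < α) (ht : 0 < t) :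
    g α t ≤ t⁻¹ := by
  rw [← one_div, le_div_iff₀ ht, mul_comm]
  exact (hA.filter_range α hα t ht).2

lemma qoFilter_nonneg (hA : StructuralAssumption T g φ κ) {α t : ℝ} (hα : 0 < α) (ht : 0 < t) :
    0 ≤ qoFilter g α t := mul_nonneg (hA.residual_nonneg hα ht) (hA.filter_nonneg hα ht)

lemma exists_filter_le (hA : StructuralAssumption T g φ κ) :
    ∃ C > 0, ∀ α > 0, ∀ t > 0, g α t ≤ C / α := by
  obtain ⟨c₃, hc₃, c₄, hc₄, h⟩ := hA.filter_two_sided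
  refine ⟨max c₄ 1, by positivity, fun α hα t ht => ?_⟩
  rcases lt_or_ge t α with h1 | h1
  · exact (h α hα t ⟨ht, h1⟩).2.trans (by gcongr; exact le_max_left _ _)
  · refine (hA.filter_le_inv hα ht).trans ?_
    rw [← one_div]
    gcongr
    exact le_max_right _ _

/-- On (0, α) multiply the two lower bounds. Continuity adds the endpoint t = α, which matters
because the noise condition integrates over (0, α]. -/
lemma exists_le_qoFilter (hA : StructuralAssumption T g φ κ)
    (hg : ContinuousOn (fun p : ℝ × ℝ => g p.1 p.2) (Ioi 0 ×ˢ Ioi 0)) :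
    ∃ c > 0, ∀ α > 0, ∀ t ∈ Ioc 0 α, c / α ≤ qoFilter g α t := by
  obtain ⟨c₂, hc₂, h₂⟩ := hA.residual_lower
  obtain ⟨c₃, hc₃, c₄, hc₄, h₃⟩ := hA.filter_two_sided
  refine ⟨c₂ * c₃, by positivity, fun α hα => ?_⟩
  have hcl : ∀ t ∈ Ioo 0 α, c₂ * c₃ / α ≤ qoFilter g α t := fun t ht => by
    rw [mul_div_assoc]
    exact mul_le_mul (h₂ α hα t ht) (h₃ α hα t ht).1 (by positivity)
      (hA.residual_nonneg hα ht.1)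
  have hcont : ContinuousOn (qoFilter g α) (Ioi 0) := by
    have := continuousOn_filter hg hα
    unfold qoFilter
    fun_prop
  intro t ht
  rcases ht.2.lt_or_eq with h1 | rfl
  · exact hcl t ⟨ht.1, h1⟩
  · have h1 : Tendsto (qoFilter g t) (𝓝[<] t) (𝓝 (qoFilter g t t)) :=
      ((hcont t ht.1).continuousAt (Ioi_mem_nhds ht.1)).tendsto.mono_left nhdsWithin_le_nhds
    refine ge_of_tendsto h1 ?_
    filter_upwards [Ioo_mem_nhdsLT ht.1] with s hs using hcl s hs

lemma qoFilter_lower_pos (hA : StructuralAssumption T g φ κ) {t : ℝ} (ht : 0 < t) :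
    ∃ c > 0, ∀ α ∈ Ioc 0 ‖T‖, c * α ≤ qoFilter g α t := by
  refine ⟨_, hA.lower_qualification t ht, fun α hα => ?_⟩
  have hb : BddBelow (range fun α : Ioc (0 : ℝ) ‖T‖ => (1 - t * g α t) * g α t / (α : ℝ)) := by
    refine ⟨0, ?_⟩
    rintro _ ⟨β, rfl⟩
    exact div_nonneg (hA.qoFilter_nonneg β.2.1 ht) β.2.1.le
  rw [← le_div_iff₀ hα.1]
  exact ciInf_le hb (⟨α, hα⟩ : Ioc (0 : ℝ) ‖T‖)

/-- A zero of κ at t would, by `kappa_covered` at α = t, force κ to vanish at all larger arguments.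
-/
lemma kappa_pos (hA : StructuralAssumption T g φ κ) (hκ : IsIndexFunction κ)
    (hκ0 : ∃ t > 0, κ t ≠ 0) {t : ℝ} (ht : 0 < t) : 0 < κ t := by
  obtain ⟨s, hs, hs0⟩ := hκ0
  obtain ⟨c, hc, h⟩ := hA.kappa_covered
  refine (hκ.nonneg t ht).lt_of_ne fun h0 => ?_
  have hsp : 0 < κ s := (hκ.nonneg s hs).lt_of_ne' hs0
  have hts : t < s := by
    by_contra! hle
    exact (hsp.trans_le (hκ.monotoneOn hs ht hle)).ne h0
  have h1 := h t ht s hts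
  rw [← h0, zero_div, mul_zero] at h1
  exact absurd h1 (not_le.2 (div_pos hsp (Real.sqrt_pos.2 hs)))

/-- If φ vanished at some α ≤ ‖T‖, the qualification would give r_α(s) = 0 wherever φ(s) ≠ 0,
against `lower_qualification`. -/
lemma phi_pos (hA : StructuralAssumption T g φ κ) (hφ : IsIndexFunction φ) (hT0 : 0 < ‖T‖)
    (hφ0 : ∃ t > 0, φ t ≠ 0) {t : ℝ} (ht : 0 < t) : 0 < φ t := by
  obtain ⟨s, hs, hs0⟩ := hφ0
  obtain ⟨c, hc, h⟩ := hA.qualification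
  refine (hφ.nonneg t ht).lt_of_ne fun h0 => ?_
  have hm : 0 < min t ‖T‖ := lt_min ht hT0
  have hm0 : φ (min t ‖T‖) = 0 := le_antisymm
    ((hφ.monotoneOn hm ht (min_le_left _ _)).trans h0.ge) (hφ.nonneg _ hm)
  have h1 := h _ hm s hs
  rw [hm0, mul_zero, abs_nonpos_iff, mul_eq_zero, or_iff_right hs0] at h1
  obtain ⟨d, hd, hqo⟩ := hA.qoFilter_lower_pos hs
  have h2 := hqo _ ⟨hm, min_le_right _ _⟩
  rw [qoFilter, h1, zero_mul] at h2
  exact absurd h2 (not_le.2 (mul_pos hd hm))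

/-- Makes the unweighted functional ψ the special case of weight 1, so one argument serves both
functionals. -/
lemma one (hA : StructuralAssumption T g φ κ) (hφ : IsIndexFunction φ) :
    StructuralAssumption T g φ (fun _ => 1) where
  filter_range := hA.filter_range
  filter_sqrt := hA.filter_sqrt
  residual_lower := hA.residual_lower
  filter_two_sided := hA.filter_two_sided
  lower_qualification := hA.lower_qualification
  qualification := hA.qualification
  qualification_kappa := by simpa using hA.qualification
  kappa_covered := ⟨1, one_pos, fun α hα t ht => by
    rw [one_mul]
    gcongr⟩
  regular_variation c₈ hc₈ := by
    obtain ⟨c₉, hc₉, δ₀, hδ₀, h⟩ := hA.regular_variation c₈ hc₈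
    refine ⟨max c₉ 1, by positivity, δ₀, hδ₀, fun δ hδ => ⟨?_, by simp⟩⟩
    exact (h δ hδ).1.trans (mul_le_mul_of_nonneg_right (le_max_left _ _) (hφ.nonneg δ hδ.1))

end StructuralAssumption

end Filters

/-! ### Upper and lower estimates for the quasi-optimality functional. -/

section QuasiOptimality

variable {𝕜 X Y : Type*} [RCLike 𝕜]
  [NormedAddCommGroup X] [InnerProductSpace 𝕜 X] [CompleteSpace X]
  [NormedAddCommGroup Y] [InnerProductSpace 𝕜 Y] [CompleteSpace Y]
  {T : X →L[𝕜] Y} {g : ℝ → ℝ → ℝ} {φ κ ω : ℝ → ℝ}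

lemma isIndexFunction_one : IsIndexFunction fun _ => 1 where
  continuousOn := continuousOn_const
  nonneg _ _ := zero_le_one
  monotoneOn := monotoneOn_const

lemma StructuralAssumption.admissible_filter (hA : StructuralAssumption T g φ κ)
    (hT : Function.Injective T)
    (hg : ContinuousOn (fun p : ℝ × ℝ => g p.1 p.2) (Ioi 0 ×ˢ Ioi 0)) {α : ℝ} (hα : 0 < α) :
    Admissible (TstarT T) (g α) := by
  obtain ⟨C, hC, h⟩ := hA.exists_filter_le
  refine admissible_of_continuousOn (isPositive_TstarT T) (injective_TstarT hT)
    (continuousOn_filter hg hα) ⟨1, one_pos, C / α, fun t ht => ?_⟩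
  rw [abs_of_nonneg (hA.filter_nonneg hα ht.1)]
  exact h α hα t ht.1

lemma StructuralAssumption.admissible_qoFilter (hA : StructuralAssumption T g φ κ)
    (hT : Function.Injective T)
    (hg : ContinuousOn (fun p : ℝ × ℝ => g p.1 p.2) (Ioi 0 ×ˢ Ioi 0)) {α : ℝ} (hα : 0 < α) :
    Admissible (TstarT T) (qoFilter g α) :=
  (((Admissible.const _ 1).sub ((Admissible.id _).mul (hA.admissible_filter hT hg hα))).mul
    (hA.admissible_filter hT hg hα))

lemma StructuralAssumption.qoResidual_eq (hA : StructuralAssumption T g φ κ)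
    (hT : Function.Injective T)
    (hg : ContinuousOn (fun p : ℝ × ℝ => g p.1 p.2) (Ioi 0 ×ˢ Ioi 0)) {α : ℝ} (hα : 0 < α) (z : Y) :
    qoResidual T g α z
      = funCalc (TstarT T) (qoFilter g α) (ContinuousLinearMap.adjoint T z) := by
  have hp := isPositive_TstarT T
  have hadm := hA.admissible_filter hT hg hα
  have h1 : qoFilter g α = fun t => g α t - t * (g α t * g α t) := by
    ext t; rw [qoFilter]; ring
  rw [h1, funCalc_sub hp hadm ((Admissible.id _).mul (hadm.mul hadm)),
    funCalc_mul hp (Admissible.id _) (hadm.mul hadm), funCalc_mul hp hadm hadm, funCalc_id hp]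
  rfl

lemma StructuralAssumption.psiKappa_eq (hA : StructuralAssumption T g φ κ)
    (hT : Function.Injective T)
    (hg : ContinuousOn (fun p : ℝ × ℝ => g p.1 p.2) (Ioi 0 ×ˢ Ioi 0))
    (hω : Admissible (TstarT T) ω) {α : ℝ} (hα : 0 < α) (z : Y) :
    psiKappa T g ω α z = ‖funCalc (TstarT T) (fun t => ω t * qoFilter g α t)
      (ContinuousLinearMap.adjoint T z)‖ := by
  rw [psiKappa, hA.qoResidual_eq hT hg hα,
    funCalc_mul (isPositive_TstarT T) hω (hA.admissible_qoFilter hT hg hα)]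

lemma psi_eq_psiKappa_one (T : X →L[𝕜] Y) (g : ℝ → ℝ → ℝ) (α : ℝ) (z : Y) :
    psi T g α z = psiKappa T g (fun _ => 1) α z := by
  rw [psiKappa, funCalc_one (isPositive_TstarT T)]
  rfl

lemma StructuralAssumption.psiKappa_sub_le (hA : StructuralAssumption T g φ κ)
    (hT : Function.Injective T)
    (hg : ContinuousOn (fun p : ℝ × ℝ => g p.1 p.2) (Ioi 0 ×ˢ Ioi 0))
    (hω : Admissible (TstarT T) ω) {α : ℝ} (hα : 0 < α) (z w : Y) :
    psiKappa T g ω α (z - w) ≤ psiKappa T g ω α z + psiKappa T g ω α w := by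
  simp only [hA.psiKappa_eq hT hg hω hα, map_sub]
  exact norm_sub_le _ _

lemma StructuralAssumption.psiKappa_le_add_sub (hA : StructuralAssumption T g φ κ)
    (hT : Function.Injective T)
    (hg : ContinuousOn (fun p : ℝ × ℝ => g p.1 p.2) (Ioi 0 ×ˢ Ioi 0))
    (hω : Admissible (TstarT T) ω) {α : ℝ} (hα : 0 < α) (z w : Y) :
    psiKappa T g ω α z ≤ psiKappa T g ω α (z - w) + psiKappa T g ω α w := by
  simp only [hA.psiKappa_eq hT hg hω hα, map_sub]
  exact norm_le_norm_sub_add _ _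

/-- Under the source condition `x = φ(T*T) w`, the functional of exact data is `O(κ(α) φ(α))`. -/
lemma StructuralAssumption.exists_psiKappa_exact_le (hA : StructuralAssumption T g φ κ)
    (hT : Function.Injective T)
    (hg : ContinuousOn (fun p : ℝ × ℝ => g p.1 p.2) (Ioi 0 ×ˢ Ioi 0))
    (hφ : IsIndexFunction φ) (hκ : IsIndexFunction κ) (w : X) :
    ∃ C > 0, ∀ α > 0, psiKappa T g κ α (T (funCalc (TstarT T) φ w)) ≤ C * (κ α * φ α) := by
  obtain ⟨c, hc, hq⟩ := hA.qualification_kappa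
  have hp := isPositive_TstarT T
  have hinj := injective_TstarT hT
  have hadφ := hφ.admissible hp hinj
  have hadκ := hκ.admissible hp hinj
  refine ⟨c * (‖w‖ + 1), by positivity, fun α hα => ?_⟩
  have hqo := hA.admissible_qoFilter hT hg hα
  have h1 : ContinuousLinearMap.adjoint T (T (funCalc (TstarT T) φ w))
      = funCalc (TstarT T) (fun t => t * φ t) w := by
    rw [funCalc_mul hp (.id _) hadφ, funCalc_id hp]
    rfl
  have had := (Admissible.id (TstarT T)).mul hadφ
  rw [hA.psiKappa_eq hT hg hadκ hα, h1, ← funCalc_mul hp (hadκ.mul hqo) had]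
  have hnn : 0 ≤ κ α * φ α := mul_nonneg (hκ.nonneg α hα) (hφ.nonneg α hα)
  refine (norm_funCalc_le hp hinj ((hadκ.mul hqo).mul had) (C := c * (κ α * φ α)) (by positivity)
    (fun t ht => ?_) w).trans ?_
  · have h2 : κ t * qoFilter g α t * (t * φ t) = κ t * φ t * (1 - t * g α t) * (t * g α t) := by
      rw [qoFilter]; ring
    rw [h2, abs_mul, abs_of_nonneg (hA.filter_range α hα t ht).1]
    exact (mul_le_of_le_one_right (abs_nonneg _) (hA.filter_range α hα t ht).2).trans
      (hq α hα t ht)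
  · nlinarith [mul_nonneg hc.le hnn]

/-- The propagated data noise in the functional is `O(κ(α) δ / √α)`. -/
lemma StructuralAssumption.exists_psiKappa_noise_le (hA : StructuralAssumption T g φ κ)
    (hT : Function.Injective T)
    (hg : ContinuousOn (fun p : ℝ × ℝ => g p.1 p.2) (Ioi 0 ×ˢ Ioi 0))
    (hκ : IsIndexFunction κ) :
    ∃ C > 0, ∀ α > 0, ∀ e : Y, psiKappa T g κ α e ≤ C * (κ α / √α * ‖e‖) := by
  obtain ⟨c₁, hc₁, h₁⟩ := hA.filter_sqrt
  obtain ⟨c₇, hc₇, h₇⟩ := hA.kappa_covered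
  have hp := isPositive_TstarT T
  have hadκ := hκ.admissible hp (injective_TstarT hT)
  refine ⟨max c₁ c₇, by positivity, fun α hα e => ?_⟩
  have hsα : 0 < √α := Real.sqrt_pos.2 hα
  have hκα := hκ.nonneg α hα
  set D := max c₁ c₇ * (κ α / √α) with hD
  have hD0 : 0 ≤ D := by positivity
  -- Below α, monotonicity of κ and `filter_sqrt` suffice; above α, use t g_α(t) ≤ 1 and
  -- `kappa_covered`.
  have hpt : ∀ t > 0, √t * (κ t * g α t) ≤ D := fun t ht => by
    have hst : 0 < √t := Real.sqrt_pos.2 ht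
    rcases le_or_gt t α with hle | hlt
    · calc √t * (κ t * g α t) = κ t * (√t * g α t) := by ring
        _ ≤ κ α * (c₁ / √α) := mul_le_mul (hκ.monotoneOn ht hα hle) (h₁ α hα t ht)
            (mul_nonneg hst.le (hA.filter_nonneg hα ht)) hκα
        _ = c₁ * (κ α / √α) := by ring
        _ ≤ D := by rw [hD]; gcongr; exact le_max_left _ _
    · calc √t * (κ t * g α t) = κ t / √t * (t * g α t) := by
            nth_rw 1 [← Real.div_sqrt (x := t)]
            ring
        _ ≤ κ t / √t := mul_le_of_le_one_right (div_nonneg (hκ.nonneg t ht) hst.le)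
            (hA.filter_range α hα t ht).2
        _ ≤ c₇ * (κ α / √α) := h₇ α hα t hlt
        _ ≤ D := by rw [hD]; gcongr; exact le_max_right _ _
  have hfin := isFiniteMeasure_spectralMeasure (isPositive_TTstar T) e
  rw [hA.psiKappa_eq hT hg hadκ hα, ← mul_assoc, ← hD]
  refine abs_le_of_sq_le_sq' ?_ (by positivity) |>.2
  rw [norm_funCalc_sq hp (hadκ.mul (hA.admissible_qoFilter hT hg hα)),
    integral_spectralMeasure_adjoint, mul_pow, ← spectralMeasure_real_univ (isPositive_TTstar T) e]
  refine (integral_mono_of_nonneg ?_ (integrable_const (D ^ 2)) ?_).trans (by simp [mul_comm])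
  · filter_upwards [ae_mem_spectralMeasure (isPositive_TTstar T) e] with t ht
    exact mul_nonneg ht.1 (sq_nonneg _)
  · filter_upwards [ae_mem_spectralMeasure (isPositive_TTstar T) e] with t ht
    rcases ht.1.eq_or_lt with rfl | h0
    -- An atom of the TT* measure at 0 is harmless, since the density factor t vanishes there.
    · simpa using sq_nonneg D
    · have hnn : 0 ≤ √t * (κ t * g α t) :=
        mul_nonneg (Real.sqrt_nonneg _) (mul_nonneg (hκ.nonneg t h0) (hA.filter_nonneg hα h0))
      have h2 : t * (κ t * qoFilter g α t) ^ 2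
          = ((1 - t * g α t) * (√t * (κ t * g α t))) ^ 2 := by
        nth_rw 1 [← Real.mul_self_sqrt h0.le]
        rw [qoFilter]; ring
      rw [h2]
      refine pow_le_pow_left₀ (mul_nonneg (hA.residual_nonneg hα h0) hnn) ?_ 2
      exact (mul_le_of_le_one_left hnn (hA.residual_le_one hα h0)).trans (hpt t h0)

/-- The Muckenhoupt-type condition on the spectral measure of `T*T` at `v`. -/
def MuckenhouptAt (T : X →L[𝕜] Y) (κ : ℝ → ℝ) (c : ℝ) (v : X) : Prop :=
  ∀ α > 0, α ^ 2 * ∫ t in Ioi α, (t⁻¹ * κ t) ^ 2 ∂(spectralMeasure (TstarT T) v)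
    ≤ c * ∫ t in Ioc 0 α, κ t ^ 2 ∂(spectralMeasure (TstarT T) v)

/-- The spectral measure at T*(y^δ - y) has density t with respect to that at y^δ - y; this absorbs
one power of t on each side. -/
lemma NoiseCondition.muckenhouptAt {y : Y} {yδ : ℝ → Y} (hN : NoiseCondition T κ y yδ) :
    ∃ c > 0, ∀ᶠ δ in 𝓝[>] (0 : ℝ),
      MuckenhouptAt T κ c (ContinuousLinearMap.adjoint T (yδ δ - y)) := by
  obtain ⟨c, hc, δ₀, hδ₀, h⟩ := hN
  refine ⟨c, hc, ?_⟩
  filter_upwards [Ioo_mem_nhdsGT hδ₀] with δ hδ α hα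
  rw [setIntegral_spectralMeasure_adjoint _ _ _ measurableSet_Ioi,
    setIntegral_spectralMeasure_adjoint _ _ _ measurableSet_Ioc]
  convert h δ hδ α hα using 2
  refine setIntegral_congr_fun measurableSet_Ioi fun t ht => ?_
  have : t ≠ 0 := (hα.trans ht).ne'
  field_simp

lemma integrableOn_inv_mul_sq (hT : Function.Injective T) (hκ : IsIndexFunction κ) {α : ℝ}
    (hα : 0 < α) (v : X) :
    IntegrableOn (fun t => (t⁻¹ * κ t) ^ 2) (Ioi α) (spectralMeasure (TstarT T) v) := by
  have hp := isPositive_TstarT T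
  have := isFiniteMeasure_spectralMeasure hp v
  have hint := (hκ.admissible hp (injective_TstarT hT)).pow_two.integrable hp v
  refine ((hint.const_mul ((α⁻¹) ^ 2)).integrableOn (s := Ioi α)).mono' ?_ ?_
  · refine ContinuousOn.aestronglyMeasurable ?_ measurableSet_Ioi
    have h1 : ContinuousOn κ (Ioi α) := hκ.continuousOn.mono (Ioi_subset_Ioi hα.le)
    have h2 : ContinuousOn (fun t : ℝ => t⁻¹) (Ioi α) :=
      continuousOn_inv₀.mono fun t ht => (hα.trans ht).ne'
    exact (h2.mul h1).pow 2
  · filter_upwards [ae_restrict_mem measurableSet_Ioi] with t ht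
    rw [Real.norm_of_nonneg (sq_nonneg _), mul_pow]
    have : t⁻¹ ≤ α⁻¹ := inv_anti₀ hα (le_of_lt ht)
    have : 0 ≤ t⁻¹ := inv_nonneg.2 (hα.trans ht).le
    gcongr

/-- Since κ increases, κ ≥ κ(α) in the left integral and κ ≤ κ(α) in the right one; the common
positive factor κ(α)² cancels. -/
lemma MuckenhouptAt.one {c : ℝ} {v : X} (h : MuckenhouptAt T κ c v) (hc : 0 < c)
    (hT : Function.Injective T) (hκ : IsIndexFunction κ) (hκpos : ∀ t > 0, 0 < κ t) :
    MuckenhouptAt T (fun _ => 1) c v := by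
  intro α hα
  have hp := isPositive_TstarT T
  have := isFiniteMeasure_spectralMeasure hp v
  have hint := (hκ.admissible hp (injective_TstarT hT)).pow_two.integrable hp v
  have hκα := hκpos α hα
  set μ := spectralMeasure (TstarT T) v
  have h1 : κ α ^ 2 * ∫ t in Ioi α, (t⁻¹ * 1) ^ 2 ∂μ ≤ ∫ t in Ioi α, (t⁻¹ * κ t) ^ 2 ∂μ := by
    rw [← integral_const_mul]
    refine setIntegral_mono_on ((integrableOn_inv_mul_sq hT isIndexFunction_one hα v).const_mul _)
      (integrableOn_inv_mul_sq hT hκ hα v) measurableSet_Ioi fun t ht => ?_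
    rw [mul_one, mul_pow, mul_comm]
    have := hκ.monotoneOn hα (hα.trans ht) (le_of_lt ht)
    gcongr
  have h2 : ∫ t in Ioc 0 α, κ t ^ 2 ∂μ ≤ κ α ^ 2 * ∫ t in Ioc 0 α, (1 : ℝ) ^ 2 ∂μ := by
    rw [← integral_const_mul]
    refine setIntegral_mono_on hint.integrableOn (integrable_const _) measurableSet_Ioc
      fun t ht => ?_
    have h3 := hκ.monotoneOn ht.1 hα ht.2
    have h4 := hκ.nonneg t ht.1
    simpa using pow_le_pow_left₀ h4 h3 2
  refine le_of_mul_le_mul_left ?_ (pow_pos hκα 2)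
  calc κ α ^ 2 * (α ^ 2 * ∫ t in Ioi α, (t⁻¹ * 1) ^ 2 ∂μ)
      = α ^ 2 * (κ α ^ 2 * ∫ t in Ioi α, (t⁻¹ * 1) ^ 2 ∂μ) := by ring
    _ ≤ α ^ 2 * ∫ t in Ioi α, (t⁻¹ * κ t) ^ 2 ∂μ := by gcongr
    _ ≤ c * ∫ t in Ioc 0 α, κ t ^ 2 ∂μ := h α hα
    _ ≤ c * (κ α ^ 2 * ∫ t in Ioc 0 α, (1 : ℝ) ^ 2 ∂μ) := by gcongr
    _ = _ := by ring

/-- Under the Muckenhoupt-type condition the propagated noise is controlled by the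
quasi-optimality functional of the noise, with any weight that dominates `κ` near `0`. -/
lemma StructuralAssumption.exists_norm_filter_le (hA : StructuralAssumption T g φ κ)
    (hT : Function.Injective T)
    (hg : ContinuousOn (fun p : ℝ × ℝ => g p.1 p.2) (Ioi 0 ×ˢ Ioi 0))
    (hκ : IsIndexFunction κ) (hω : IsIndexFunction ω) {c : ℝ} (hc : 0 < c) :
    ∃ C > 0, ∀ e : Y, MuckenhouptAt T κ c (ContinuousLinearMap.adjoint T e) →
      ∀ α > 0, ∀ b ≥ 0, (∀ t ∈ Ioc 0 α, κ t ≤ b * ω t) →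
        ‖funCalc (TstarT T) (fun t => κ t * g α t) (ContinuousLinearMap.adjoint T e)‖
          ≤ C * (b * psiKappa T g ω α e) := by
  obtain ⟨c₄, hc₄, h₄⟩ := hA.exists_filter_le
  obtain ⟨c₃, hc₃, h₃⟩ := hA.exists_le_qoFilter hg
  have hp := isPositive_TstarT T
  have hinj := injective_TstarT hT
  have hadκ := hκ.admissible hp hinj
  have hadω := hω.admissible hp hinj
  -- With J the integral of κ² over (0, α], low frequencies contribute at most (c₄/α)²J and high
  -- ones cJ/α², while (c₃/α)²J ≤ b²ψ_ω².
  set K := (c₄ ^ 2 + c) / c₃ ^ 2 with hK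
  have hK0 : 0 < K := by positivity
  refine ⟨√K, Real.sqrt_pos.2 hK0, fun e he α hα b hb hκω => ?_⟩
  set v := ContinuousLinearMap.adjoint T e
  have hfin := isFiniteMeasure_spectralMeasure hp v
  have hadg := hA.admissible_filter hT hg hα
  have hadq := hA.admissible_qoFilter hT hg hα
  have hintκ := hadκ.pow_two.integrable hp v
  have hintg := (hadκ.mul hadg).pow_two.integrable hp v
  have hintq := (hadω.mul hadq).pow_two.integrable hp v
  have hpos := ae_pos_spectralMeasure hp hinj v
  have hpsi : psiKappa T g ω α e ^ 2
      = ∫ t, (ω t * qoFilter g α t) ^ 2 ∂(spectralMeasure (TstarT T) v) := by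
    rw [hA.psiKappa_eq hT hg hadω hα, norm_funCalc_sq hp (hadω.mul hadq)]
  have hpsi0 : 0 ≤ psiKappa T g ω α e := norm_nonneg _
  refine abs_le_of_sq_le_sq' ?_ (by positivity) |>.2
  rw [norm_funCalc_sq hp (hadκ.mul hadg), mul_pow, Real.sq_sqrt hK0.le, mul_pow, hpsi]
  have hM := he α hα
  set μ := spectralMeasure (TstarT T) v
  set J := ∫ t in Ioc 0 α, κ t ^ 2 ∂μ with hJ
  have h1 : ∫ t in Ioc 0 α, (κ t * g α t) ^ 2 ∂μ ≤ (c₄ / α) ^ 2 * J := by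
    rw [hJ, ← integral_const_mul]
    refine setIntegral_mono_on hintg.integrableOn (hintκ.integrableOn.const_mul _)
      measurableSet_Ioc fun t ht => ?_
    rw [mul_pow, mul_comm]
    have := h₄ α hα t ht.1
    have := hA.filter_nonneg hα ht.1
    gcongr
  have h2 : ∫ t in Ioi α, (κ t * g α t) ^ 2 ∂μ ≤ ∫ t in Ioi α, (t⁻¹ * κ t) ^ 2 ∂μ := by
    refine setIntegral_mono_on hintg.integrableOn (integrableOn_inv_mul_sq hT hκ hα v)
      measurableSet_Ioi fun t ht => ?_
    have ht0 : 0 < t := hα.trans ht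
    have := hA.filter_le_inv hα ht0
    have := hA.filter_nonneg hα ht0
    have := hκ.nonneg t ht0
    rw [mul_comm]
    gcongr
  have h3 : (c₃ / α) ^ 2 * J ≤ b ^ 2 * ∫ t, (ω t * qoFilter g α t) ^ 2 ∂μ := by
    have h4 : (c₃ / α) ^ 2 * J ≤ b ^ 2 * ∫ t in Ioc 0 α, (ω t * qoFilter g α t) ^ 2 ∂μ := by
      rw [hJ, ← integral_const_mul, ← integral_const_mul]
      refine setIntegral_mono_on (hintκ.integrableOn.const_mul _) (hintq.integrableOn.const_mul _)
        measurableSet_Ioc fun t ht => ?_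
      rw [← mul_pow, ← mul_pow]
      have h5 := h₃ α hα t ht
      have h6 := hκω t ht
      have h7 := hκ.nonneg t ht.1
      refine pow_le_pow_left₀ (by positivity) ?_ 2
      calc c₃ / α * κ t ≤ qoFilter g α t * (b * ω t) :=
            mul_le_mul h5 h6 h7 (hA.qoFilter_nonneg hα ht.1)
        _ = _ := by ring
    exact h4.trans (mul_le_mul_of_nonneg_left
      (setIntegral_le_integral hintq (.of_forall fun t => sq_nonneg _)) (sq_nonneg b))
  have hsplit : ∫ t, (κ t * g α t) ^ 2 ∂μ
      = ∫ t in Ioc 0 α, (κ t * g α t) ^ 2 ∂μ + ∫ t in Ioi α, (κ t * g α t) ^ 2 ∂μ := by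
    rw [← setIntegral_union (Set.Ioc_disjoint_Ioi le_rfl) measurableSet_Ioi hintg.integrableOn
      hintg.integrableOn, Ioc_union_Ioi_eq_Ioi hα.le,
      Measure.restrict_eq_self_of_ae_mem (s := Ioi 0) (hpos.mono fun t ht => ht.1)]
  have hM' : ∫ t in Ioi α, (t⁻¹ * κ t) ^ 2 ∂μ ≤ c / α ^ 2 * J := by
    rw [div_mul_eq_mul_div, le_div_iff₀ (by positivity), mul_comm]
    exact hM
  calc ∫ t, (κ t * g α t) ^ 2 ∂μ ≤ (c₄ / α) ^ 2 * J + c / α ^ 2 * J := by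
        rw [hsplit]; exact add_le_add h1 (h2.trans hM')
    _ = K * ((c₃ / α) ^ 2 * J) := by rw [hK]; field_simp
    _ ≤ _ := by gcongr

/-- Error decomposition into propagated noise and approximation error. -/
lemma StructuralAssumption.exists_norm_error_le (hA : StructuralAssumption T g φ κ)
    (hT : Function.Injective T)
    (hg : ContinuousOn (fun p : ℝ × ℝ => g p.1 p.2) (Ioi 0 ×ˢ Ioi 0))
    (hφ : IsIndexFunction φ) (hκ : IsIndexFunction κ) (w : X) :
    ∃ C > 0, ∀ α > 0, ∀ z : Y,
      ‖funCalc (TstarT T) κ (regSol T g α z - funCalc (TstarT T) φ w)‖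
        ≤ ‖funCalc (TstarT T) (fun t => κ t * g α t)
            (ContinuousLinearMap.adjoint T (z - T (funCalc (TstarT T) φ w)))‖
          + C * (κ α * φ α) := by
  obtain ⟨c, hc, hq⟩ := hA.qualification_kappa
  have hp := isPositive_TstarT T
  have hinj := injective_TstarT hT
  have hadφ := hφ.admissible hp hinj
  have hadκ := hκ.admissible hp hinj
  refine ⟨c * (‖w‖ + 1), by positivity, fun α hα z => ?_⟩
  have hadg := hA.admissible_filter hT hg hα
  have hadr := (Admissible.const (TstarT T) 1).sub ((Admissible.id _).mul hadg)
  set x := funCalc (TstarT T) φ w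
  have h1 : funCalc (TstarT T) (fun t => 1 - t * g α t) x
      = x - funCalc (TstarT T) (g α) (TstarT T x) := by
    have h2 : (fun t => t * g α t) = fun t => g α t * t := by ext t; ring
    rw [funCalc_sub hp (.const _ 1) ((Admissible.id _).mul hadg), funCalc_one hp, h2,
      funCalc_mul hp hadg (.id _), funCalc_id hp]
    rfl
  have h3 : funCalc (TstarT T) κ (regSol T g α z - x)
      = funCalc (TstarT T) (fun t => κ t * g α t) (ContinuousLinearMap.adjoint T (z - T x))
        - funCalc (TstarT T) (fun t => κ t * (φ t * (1 - t * g α t))) w := by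
    have h4 : (fun t => φ t * (1 - t * g α t)) = fun t => (1 - t * g α t) * φ t := by
      ext t; ring
    rw [funCalc_mul hp hadκ hadg, funCalc_mul hp hadκ (hadφ.mul hadr), h4,
      funCalc_mul hp hadr hadφ, h1, ← map_sub]
    congr 1
    have h5 : TstarT T x = ContinuousLinearMap.adjoint T (T x) := rfl
    rw [regSol, h5, map_sub, map_sub]
    abel
  rw [h3]
  refine (norm_sub_le _ _).trans (add_le_add le_rfl ?_)
  have hnn : 0 ≤ κ α * φ α := mul_nonneg (hκ.nonneg α hα) (hφ.nonneg α hα)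
  refine (norm_funCalc_le hp hinj (hadκ.mul (hadφ.mul hadr)) (C := c * (κ α * φ α))
    (by positivity) (fun t ht => ?_) w).trans ?_
  · rw [← mul_assoc]
    exact hq α hα t ht
  · nlinarith [mul_nonneg hc.le hnn]

/-- The functional of noisy data is bounded below by a multiple of `α`. -/
lemma StructuralAssumption.exists_le_psiKappa (hA : StructuralAssumption T g φ κ)
    (hT : Function.Injective T)
    (hg : ContinuousOn (fun p : ℝ × ℝ => g p.1 p.2) (Ioi 0 ×ˢ Ioi 0))
    (hω : IsIndexFunction ω) (hωpos : ∀ t > 0, 0 < ω t) {y : Y}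
    (hy : ContinuousLinearMap.adjoint T y ≠ 0) {yδ : ℝ → Y}
    (hyδ : ∀ δ ∈ Ioo (0 : ℝ) 1, ‖yδ δ - y‖ ≤ δ) :
    ∃ c > 0, ∀ᶠ δ in 𝓝[>] (0 : ℝ), ∀ α ∈ Ioc 0 ‖T‖, c * α ≤ psiKappa T g ω α (yδ δ) := by
  have hp := isPositive_TstarT T
  have hinj := injective_TstarT hT
  have hadω := hω.admissible hp hinj
  set v := ContinuousLinearMap.adjoint T y
  have hfin := isFiniteMeasure_spectralMeasure hp v
  have hpos : ∀ n : ℕ, (0 : ℝ) < 1 / (n + 1) := fun _ => Nat.one_div_pos_of_nat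
  let I : ℕ → Set ℝ := fun n => Icc (1 / (n + 1) : ℝ) (n + 1)
  have hIsub : ∀ n, I n ⊆ Ioi 0 := fun n t ht => (hpos n).trans_le ht.1
  -- Sets on which ω ≥ q and r_α g_α ≥ qα for all α ≤ ‖T‖ at once, with q = 1/(n+1). The
  -- intersection over α is uncountable, so measurability comes from closedness; intersecting with a
  -- compact interval in (0, ∞) makes relative closedness genuine.
  let S : ℕ → Set ℝ := fun n => (I n ∩ ω ⁻¹' Ici (1 / (n + 1))) ∩
    ⋂ α ∈ Ioc 0 ‖T‖, I n ∩ qoFilter g α ⁻¹' Ici (1 / (n + 1) * α)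
  have hmeas : ∀ n, MeasurableSet (S n) := fun n => by
    refine (IsClosed.inter ?_ (isClosed_biInter fun α hα => ?_)).measurableSet
    · exact (hω.continuousOn.mono (hIsub n)).preimage_isClosed_of_isClosed isClosed_Icc isClosed_Ici
    · have hc : ContinuousOn (qoFilter g α) (Ioi 0) := by
        have := continuousOn_filter hg hα.1
        unfold qoFilter
        fun_prop
      exact (hc.mono (hIsub n)).preimage_isClosed_of_isClosed isClosed_Icc isClosed_Ici
  have hcover : Ioi 0 ⊆ ⋃ n, S n := fun t ht => by
    obtain ⟨c, hc, hqo⟩ := hA.qoFilter_lower_pos ht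
    have hz : Tendsto (fun n : ℕ => 1 / ((n : ℝ) + 1)) atTop (𝓝 0) :=
      tendsto_one_div_add_atTop_nhds_zero_nat
    obtain ⟨n, hn1, hn2, hn3, hn4⟩ := ((hz.eventually_lt_const ht).and
      ((hz.eventually_lt_const (hωpos t ht)).and ((hz.eventually_lt_const hc).and
      (tendsto_natCast_atTop_atTop.eventually_ge_atTop t)))).exists
    have hI : t ∈ I n := ⟨hn1.le, by linarith⟩
    refine mem_iUnion.2 ⟨n, ⟨hI, hn2.le⟩, mem_iInter₂.2 fun α hα => ⟨hI, ?_⟩⟩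
    exact (mul_le_mul_of_nonneg_right hn3.le hα.1.le).trans (hqo α hα)
  -- The measure at T*y is nonzero and lives on (0, ∞), which the sets `S n` cover.
  obtain ⟨n, hn⟩ : ∃ n, spectralMeasure (TstarT T) v (S n) ≠ 0 := by
    by_contra! hall
    have h0 : spectralMeasure (TstarT T) v (Ioi 0) = 0 :=
      measure_mono_null hcover (measure_iUnion_null hall)
    have h1 : spectralMeasure (TstarT T) v (Ioi 0)ᶜ = 0 :=
      ae_iff.1 ((ae_pos_spectralMeasure hp hinj v).mono fun t ht => ht.1)
    have h2 : spectralMeasure (TstarT T) v univ = 0 := by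
      rw [← union_compl_self (Ioi (0 : ℝ))]
      exact measure_union_null h0 h1
    have h3 := spectralMeasure_real_univ hp v
    rw [measureReal_def, h2, ENNReal.toReal_zero, eq_comm] at h3
    exact hy (by simpa using h3)
  set q : ℝ := 1 / ((n : ℝ) + 1) with hq
  set m := (spectralMeasure (TstarT T) v).real (S n) with hm
  have hm0 : 0 < m := ENNReal.toReal_pos hn (measure_ne_top _ _)
  -- One factor q bounds ω, the other bounds r_α g_α / α. For small δ the noise mass is below m/4,
  -- so m ≤ 2(mass + noise mass) leaves mass at least m/4 at T*y^δ.
  refine ⟨q * q * √(m / 4), by have := hpos n; positivity, ?_⟩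
  have hlim : Tendsto (fun δ : ℝ => (‖T‖ * δ) ^ 2) (𝓝[>] 0) (𝓝 0) := by
    have : Tendsto (fun δ : ℝ => (‖T‖ * δ) ^ 2) (𝓝 0) (𝓝 ((‖T‖ * 0) ^ 2)) :=
      Continuous.tendsto (by fun_prop) 0
    simpa using this.mono_left nhdsWithin_le_nhds
  filter_upwards [Ioo_mem_nhdsGT one_pos, hlim.eventually_lt_const (div_pos hm0 four_pos)]
    with δ hδ hδm α hα
  set u := ContinuousLinearMap.adjoint T (yδ δ)
  have hfinu := isFiniteMeasure_spectralMeasure hp u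
  have hfind := isFiniteMeasure_spectralMeasure hp (v - u)
  have hmass : m / 4 ≤ (spectralMeasure (TstarT T) u).real (S n) := by
    have h1 : spectralMeasure (TstarT T) v (S n) ≤ 2 * (spectralMeasure (TstarT T) u (S n)
        + spectralMeasure (TstarT T) (v - u) (S n)) := spectralMeasure_le hp v u (S n)
    have h2 : m ≤ 2 * ((spectralMeasure (TstarT T) u).real (S n)
        + (spectralMeasure (TstarT T) (v - u)).real (S n)) := by
      have h3 := ENNReal.toReal_mono (by finiteness) h1
      rwa [ENNReal.toReal_mul, ENNReal.toReal_add (by finiteness) (by finiteness)] at h3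
    have h4 : (spectralMeasure (TstarT T) (v - u)).real (S n) ≤ (‖T‖ * δ) ^ 2 := by
      refine (measureReal_mono (subset_univ _)).trans ?_
      rw [spectralMeasure_real_univ hp]
      gcongr
      rw [← map_sub]
      refine (ContinuousLinearMap.le_opNorm _ _).trans ?_
      rw [LinearIsometryEquiv.norm_map, norm_sub_rev]
      gcongr
      exact hyδ δ hδ
    linarith
  have hadq := hA.admissible_qoFilter hT hg hα.1
  have hint := (hadω.mul hadq).pow_two.integrable hp u
  rw [hA.psiKappa_eq hT hg hadω hα.1]
  refine abs_le_of_sq_le_sq' ?_ (norm_nonneg _) |>.2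
  rw [norm_funCalc_sq hp (hadω.mul hadq)]
  calc (q * q * √(m / 4) * α) ^ 2 = (q * (q * α)) ^ 2 * (m / 4) := by
        rw [mul_pow, mul_pow _ (√_), Real.sq_sqrt (by positivity)]; ring
    _ ≤ (q * (q * α)) ^ 2 * (spectralMeasure (TstarT T) u).real (S n) := by gcongr
    _ = ∫ t in S n, (q * (q * α)) ^ 2 ∂(spectralMeasure (TstarT T) u) := by
        simp [mul_comm]
    _ ≤ ∫ t in S n, (ω t * qoFilter g α t) ^ 2 ∂(spectralMeasure (TstarT T) u) := by
        refine setIntegral_mono_on (integrable_const _) hint.integrableOn (hmeas n) fun t ht => ?_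
        have h1 : q ≤ ω t := ht.1.2
        have h2 : q * α ≤ qoFilter g α t := (mem_iInter₂.1 ht.2 α hα).2
        have h3 : 0 < q := hpos n
        have h4 := hα.1
        have h5 : 0 ≤ ω t := h3.le.trans h1
        gcongr
    _ ≤ _ := setIntegral_le_integral hint (.of_forall fun t => sq_nonneg _)

end QuasiOptimality

/-! ### The inverse function of θ. -/

section ThetaInverse

variable {φ : ℝ → ℝ}

lemma theta_strictMonoOn (hφ : IsIndexFunction φ) (hφpos : ∀ t > 0, 0 < φ t) :
    StrictMonoOn (theta φ) (Ioi 0) := fun _ hs _ ht hst =>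
  mul_lt_mul' (hφ.monotoneOn hs ht hst.le) (Real.sqrt_lt_sqrt (le_of_lt hs) hst)
    (Real.sqrt_nonneg _) (hφpos _ ht)

lemma thetaInv_spec (hφ : IsIndexFunction φ) (hφpos : ∀ t > 0, 0 < φ t) {δ : ℝ} (hδ : 0 < δ) :
    0 < thetaInv φ δ ∧ theta φ (thetaInv φ δ) = δ := by
  have hφ1 : 0 < φ 1 := hφpos 1 one_pos
  -- Comparing θ(t) with φ(1)√t, which equals δ at t = q², brackets the solution between min(1, q²)
  -- and max(1, q²).
  set q := δ / φ 1 with hq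
  have hq0 : 0 < q := by positivity
  have hcont : ContinuousOn (theta φ) (Ioi 0) := hφ.continuousOn.mul Real.continuous_sqrt.continuousOn
  have hlo0 : 0 < min 1 (q ^ 2) := by positivity
  have hlo : theta φ (min 1 (q ^ 2)) ≤ δ := by
    have h1 : φ (min 1 (q ^ 2)) ≤ φ 1 :=
      hφ.monotoneOn hlo0 (mem_Ioi.2 one_pos) (min_le_left _ _)
    have h2 : √(min 1 (q ^ 2)) ≤ q :=
      (Real.sqrt_le_sqrt (min_le_right _ _)).trans_eq (Real.sqrt_sq hq0.le)
    calc theta φ (min 1 (q ^ 2)) ≤ φ 1 * q := mul_le_mul h1 h2 (Real.sqrt_nonneg _) hφ1.le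
      _ = δ := by rw [hq]; field_simp
  have hhi : δ ≤ theta φ (max 1 (q ^ 2)) := by
    have h1 : φ 1 ≤ φ (max 1 (q ^ 2)) :=
      hφ.monotoneOn (mem_Ioi.2 one_pos) (mem_Ioi.2 (one_pos.trans_le (le_max_left _ _)))
        (le_max_left _ _)
    have h2 : q ≤ √(max 1 (q ^ 2)) :=
      (Real.sqrt_sq hq0.le).symm.trans_le (Real.sqrt_le_sqrt (le_max_right _ _))
    calc δ = φ 1 * q := by rw [hq]; field_simp
      _ ≤ _ := mul_le_mul h1 h2 hq0.le (hφ1.le.trans h1)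
  have hex : ∃ t ∈ Ioi 0, theta φ t = δ := by
    obtain ⟨t, ht, h⟩ := intermediate_value_Icc (min_le_left _ _ |>.trans (le_max_left _ _))
      (hcont.mono fun t ht => hlo0.trans_le ht.1) ⟨hlo, hhi⟩
    exact ⟨t, hlo0.trans_le ht.1, h⟩
  exact ⟨Function.invFunOn_mem hex, Function.invFunOn_eq hex⟩

/-- Ensures that θ⁻¹(δ) is an admissible competitor in the minimization over (0, a]. -/
lemma eventually_thetaInv_le (hφ : IsIndexFunction φ) (hφpos : ∀ t > 0, 0 < φ t) {a : ℝ}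
    (ha : 0 < a) : ∀ᶠ δ in 𝓝[>] (0 : ℝ), thetaInv φ δ ≤ a := by
  have h0 : 0 < theta φ a := mul_pos (hφpos a ha) (Real.sqrt_pos.2 ha)
  filter_upwards [Ioo_mem_nhdsGT h0] with δ hδ
  obtain ⟨hpos, heq⟩ := thetaInv_spec hφ hφpos hδ.1
  exact ((theta_strictMonoOn hφ hφpos).le_iff_le hpos ha).1 (heq.trans_le hδ.2.le)

end ThetaInverse

/-! ### Convergence rates at the minimizers. -/

section Rates

variable {𝕜 X Y : Type*} [RCLike 𝕜]
  [NormedAddCommGroup X] [InnerProductSpace 𝕜 X] [CompleteSpace X]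
  [NormedAddCommGroup Y] [InnerProductSpace 𝕜 Y] [CompleteSpace Y]
  {T : X →L[𝕜] Y} {g : ℝ → ℝ → ℝ} {φ κ ω : ℝ → ℝ}

/-- Regular variation handles s < δ₀; for s ≥ δ₀ the right side is bounded below by a positive
constant and the left is at most its value at a. -/
lemma StructuralAssumption.exists_mul_le_of_le_mul (hA : StructuralAssumption T g φ κ)
    (hφ : IsIndexFunction φ) (hκ : IsIndexFunction κ) (hφpos : ∀ t > 0, 0 < φ t)
    (hκpos : ∀ t > 0, 0 < κ t) {a K : ℝ} (ha : 0 < a) (hK : 0 < K) :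
    ∃ C > 0, ∀ α ∈ Ioc 0 a, ∀ s > 0, α ≤ K * s → κ α * φ α ≤ C * (κ s * φ s) := by
  obtain ⟨c, hc, δ₀, hδ₀, h⟩ := hA.regular_variation K hK
  have h0 : 0 < κ δ₀ * φ δ₀ := mul_pos (hκpos _ hδ₀) (hφpos _ hδ₀)
  have h1 : 0 < κ a * φ a := mul_pos (hκpos a ha) (hφpos a ha)
  have hmono : ∀ {s t : ℝ}, 0 < s → s ≤ t → κ s * φ s ≤ κ t * φ t := fun {s t} hs hst =>
    mul_le_mul (hκ.monotoneOn hs (hs.trans_le hst) hst) (hφ.monotoneOn hs (hs.trans_le hst) hst)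
      (hφ.nonneg s hs) (hκ.nonneg t (hs.trans_le hst))
  refine ⟨max (c * c) (κ a * φ a / (κ δ₀ * φ δ₀)), by positivity, fun α hα s hs hle => ?_⟩
  have hs0 : 0 < κ s * φ s := mul_pos (hκpos s hs) (hφpos s hs)
  rcases lt_or_ge s δ₀ with hlt | hge
  · obtain ⟨h2, h3⟩ := h s ⟨hs, hlt⟩
    calc κ α * φ α ≤ κ (K * s) * φ (K * s) := hmono hα.1 hle
      _ ≤ (c * κ s) * (c * φ s) := mul_le_mul h3 h2 (hφ.nonneg _ (by positivity))
          (mul_nonneg hc.le (hκ.nonneg s hs))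
      _ = c * c * (κ s * φ s) := by ring
      _ ≤ _ := by gcongr; exact le_max_left _ _
  · calc κ α * φ α ≤ κ a * φ a := hmono hα.1 hα.2
      _ = κ a * φ a / (κ δ₀ * φ δ₀) * (κ δ₀ * φ δ₀) :=
          (div_mul_cancel₀ _ h0.ne').symm
      _ ≤ κ a * φ a / (κ δ₀ * φ δ₀) * (κ s * φ s) :=
          mul_le_mul_of_nonneg_left (hmono hδ₀ hge) (by positivity)
      _ ≤ _ := by gcongr; exact le_max_right _ _

/-- The minimal value of the functional is `O((ωφ)(θ⁻¹(δ)))`. -/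
lemma StructuralAssumption.exists_psiKappa_argmin_le (hA : StructuralAssumption T g φ ω)
    (hT : Function.Injective T)
    (hg : ContinuousOn (fun p : ℝ × ℝ => g p.1 p.2) (Ioi 0 ×ˢ Ioi 0))
    (hφ : IsIndexFunction φ) (hω : IsIndexFunction ω) (hφpos : ∀ t > 0, 0 < φ t) (w : X)
    {yδ : ℝ → Y}
    (hyδ : ∀ δ ∈ Ioo (0 : ℝ) 1, ‖yδ δ - T (funCalc (TstarT T) φ w)‖ ≤ δ) {a : ℝ} (ha : 0 < a) :
    ∃ C > 0, ∀ᶠ δ in 𝓝[>] (0 : ℝ), ∀ α,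
      IsArgmin (fun β => psiKappa T g ω β (yδ δ)) a α →
        psiKappa T g ω α (yδ δ) ≤ C * (ω (thetaInv φ δ) * φ (thetaInv φ δ)) := by
  obtain ⟨C₁, hC₁, h₁⟩ := hA.exists_psiKappa_exact_le hT hg hφ hω w
  obtain ⟨C₂, hC₂, h₂⟩ := hA.exists_psiKappa_noise_le hT hg hω
  have had := hω.admissible (isPositive_TstarT T) (injective_TstarT hT)
  refine ⟨C₂ + C₁, by positivity, ?_⟩
  filter_upwards [Ioo_mem_nhdsGT one_pos, eventually_thetaInv_le hφ hφpos ha] with δ hδ hle α hα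
  obtain ⟨hs, hθ⟩ := thetaInv_spec hφ hφpos hδ.1
  set s := thetaInv φ δ
  have hss : 0 < √s := Real.sqrt_pos.2 hs
  have hωs := hω.nonneg s hs
  -- At the competitor s one has δ = φ(s)√s, so the noise term ω(s)δ/√s equals ω(s)φ(s).
  refine (hα.2 s ⟨hs, hle⟩).trans ((hA.psiKappa_le_add_sub hT hg had hs _
    (T (funCalc (TstarT T) φ w))).trans ?_)
  rw [add_mul]
  refine add_le_add ((h₂ s hs _).trans ?_) (h₁ s hs)
  refine mul_le_mul_of_nonneg_left ?_ hC₂.le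
  calc ω s / √s * ‖yδ δ - T (funCalc (TstarT T) φ w)‖ ≤ ω s / √s * δ := by
        gcongr; exact hyδ δ hδ
    _ = ω s / √s * (φ s * √s) := by rw [← hθ]; rfl
    _ = ω s * φ s := by field_simp

/-- Rate for the error weighted by `κ(T*T)`, when `α` minimizes the functional with weight `ω`. -/
lemma exists_rate (hA : StructuralAssumption T g φ κ) (hA' : StructuralAssumption T g φ ω)
    (hT : Function.Injective T) (hT' : Function.Injective (ContinuousLinearMap.adjoint T))
    (hg : ContinuousOn (fun p : ℝ × ℝ => g p.1 p.2) (Ioi 0 ×ˢ Ioi 0))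
    (hφ : IsIndexFunction φ) (hκ : IsIndexFunction κ) (hω : IsIndexFunction ω)
    (hφpos : ∀ t > 0, 0 < φ t) (hκpos : ∀ t > 0, 0 < κ t) (hωpos : ∀ t > 0, 0 < ω t)
    {w : X} {yδ : ℝ → Y} (hy : T (funCalc (TstarT T) φ w) ≠ 0)
    (hyδ : ∀ δ ∈ Ioo (0 : ℝ) 1, ‖yδ δ - T (funCalc (TstarT T) φ w)‖ ≤ δ)
    {c : ℝ} (hc : 0 < c) (hN : ∀ᶠ δ in 𝓝[>] (0 : ℝ), MuckenhouptAt T κ c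
      (ContinuousLinearMap.adjoint T (yδ δ - T (funCalc (TstarT T) φ w))))
    {a : ℝ} (ha : 0 < a) (haT : a ≤ ‖T‖) {b : ℝ → ℝ} {D : ℝ} (hD : 0 < D)
    (hb0 : ∀ α > 0, 0 ≤ b α) (hbD : ∀ α ∈ Ioc 0 a, b α ≤ D)
    (hbω : ∀ α > 0, b α * ω α ≤ κ α)
    (hκb : ∀ α > 0, ∀ t ∈ Ioc 0 α, κ t ≤ b α * ω t) :
    ∃ C > 0, ∀ᶠ δ in 𝓝[>] (0 : ℝ), ∀ α, IsArgmin (fun β => psiKappa T g ω β (yδ δ)) a α →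
      ‖funCalc (TstarT T) κ (regSol T g α (yδ δ) - funCalc (TstarT T) φ w)‖
        ≤ C * max ((κ * φ) ((ω * φ) (thetaInv φ δ))) ((ω * φ) (thetaInv φ δ)) := by
  have had := hω.admissible (isPositive_TstarT T) (injective_TstarT hT)
  have hy' : ContinuousLinearMap.adjoint T (T (funCalc (TstarT T) φ w)) ≠ 0 := fun h0 =>
    hy (hT' (by rw [h0, map_zero]))
  obtain ⟨C₁, hC₁, h₁⟩ := hA.exists_norm_error_le hT hg hφ hκ w
  obtain ⟨C₂, hC₂, h₂⟩ := hA.exists_norm_filter_le hT hg hκ hω hc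
  obtain ⟨C₃, hC₃, h₃⟩ := hA'.exists_psiKappa_argmin_le hT hg hφ hω hφpos w hyδ ha
  obtain ⟨C₄, hC₄, h₄⟩ := hA'.exists_psiKappa_exact_le hT hg hφ hω w
  obtain ⟨d, hd, h₅⟩ := hA'.exists_le_psiKappa hT hg hω hωpos hy' hyδ
  obtain ⟨C₆, hC₆, h₆⟩ := hA.exists_mul_le_of_le_mul hφ hκ hφpos hκpos ha (div_pos hC₃ hd)
  refine ⟨C₂ * D * C₃ + (C₂ * C₄ + C₁) * C₆, by positivity, ?_⟩
  filter_upwards [self_mem_nhdsWithin, hN, h₃, h₅] with δ hδ hNδ h₃δ h₅δ α hα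
  have hα0 : 0 < α := hα.1.1
  obtain ⟨hs, -⟩ := thetaInv_spec hφ hφpos hδ
  simp only [Pi.mul_apply]
  set s := thetaInv φ δ
  set σ := ω s * φ s with hσ
  have hσ0 : 0 < σ := mul_pos (hωpos s hs) (hφpos s hs)
  -- Sandwich dα ≤ ψ_ω(α, y^δ) ≤ C₃σ; the lower bound is available because a ≤ ‖T‖.
  have hασ : α ≤ C₃ / d * σ := by
    rw [div_mul_eq_mul_div, le_div_iff₀ hd, mul_comm]
    exact (h₅δ α ⟨hα0, hα.1.2.trans haT⟩).trans (h₃δ α hα)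
  have hη := h₆ α hα.1 σ hσ0 hασ
  have hφα := (hφpos α hα0).le
  have hb := hb0 α hα0
  set ξ := T (funCalc (TstarT T) φ w)
  have hnoise : psiKappa T g ω α (yδ δ - ξ) ≤ C₃ * σ + C₄ * (ω α * φ α) :=
    (hA.psiKappa_sub_le hT hg had hα0 _ _).trans (add_le_add (h₃δ α hα) (h₄ α hα0))
  -- The factor b(α) is treated differently in the two terms: bounded by `D` in the first, absorbed
  -- through b(α)ω(α) ≤ κ(α) in the second.
  have hmain : b α * psiKappa T g ω α (yδ δ - ξ) ≤ D * (C₃ * σ) + C₄ * (κ α * φ α) := by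
    calc b α * psiKappa T g ω α (yδ δ - ξ) ≤ b α * (C₃ * σ + C₄ * (ω α * φ α)) := by gcongr
      _ = b α * (C₃ * σ) + C₄ * (b α * ω α * φ α) := by ring
      _ ≤ _ := by
        have := hbD α hα.1
        have := hbω α hα0
        gcongr
  set m := max (κ σ * φ σ) σ
  have hm1 : κ σ * φ σ ≤ m := le_max_left _ _
  have hm2 : σ ≤ m := le_max_right _ _
  calc _ ≤ C₂ * (b α * psiKappa T g ω α (yδ δ - ξ)) + C₁ * (κ α * φ α) :=
        (h₁ α hα0 (yδ δ)).trans
          (add_le_add (h₂ _ hNδ α hα0 (b α) hb (hκb α hα0)) le_rfl)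
    _ ≤ C₂ * (D * (C₃ * σ) + C₄ * (κ α * φ α)) + C₁ * (κ α * φ α) := by gcongr
    _ = C₂ * D * C₃ * σ + (C₂ * C₄ + C₁) * (κ α * φ α) := by ring
    _ ≤ C₂ * D * C₃ * m + (C₂ * C₄ + C₁) * (C₆ * m) := by
        refine add_le_add (by gcongr) (mul_le_mul_of_nonneg_left ?_ (by positivity))
        exact hη.trans (mul_le_mul_of_nonneg_left hm1 hC₆.le)
    _ = _ := by ring

end Rates

end FunctionalStrategy

/-! ### The three rates as instances of `exists_rate`. -/

theorem theorem2p1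
    {𝕜 X Y : Type*} [RCLike 𝕜]
    [NormedAddCommGroup X] [InnerProductSpace 𝕜 X] [CompleteSpace X]
    [NormedAddCommGroup Y] [InnerProductSpace 𝕜 Y] [CompleteSpace Y]
    (T : X →L[𝕜] Y) (hT : Function.Injective T)
    (hT' : Function.Injective (ContinuousLinearMap.adjoint T))
    (g : ℝ → ℝ → ℝ)
    (hg : ContinuousOn (fun p : ℝ × ℝ => g p.1 p.2) (Set.Ioi 0 ×ˢ Set.Ioi 0))
    (φ κ : ℝ → ℝ)
    (hφ : FunctionalStrategy.IsIndexFunction φ)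
    (hκ : FunctionalStrategy.IsIndexFunction κ) (hκ0 : ∃ t > 0, κ t ≠ 0)
    (hA : FunctionalStrategy.StructuralAssumption T g φ κ)
    (x f : X) (y : Y) (hxy : T x = y) (hy : y ≠ 0)
    (hx : x ∈ Set.range (FunctionalStrategy.funCalc (FunctionalStrategy.TstarT T) φ))
    (hf : f ∈ Set.range (FunctionalStrategy.funCalc (FunctionalStrategy.TstarT T) κ))
    (yδ : ℝ → Y) (hyδ : ∀ δ ∈ Set.Ioo (0 : ℝ) 1, ‖yδ δ - y‖ ≤ δ)
    (hN : FunctionalStrategy.NoiseCondition T κ y yδ)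
    (a : ℝ) (ha : 0 < a) (haT : a ≤ ‖T‖) :
    (∃ C > 0, ∀ᶠ δ in 𝓝[>] (0 : ℝ), ∀ α : ℝ,
      FunctionalStrategy.IsArgmin (fun β => FunctionalStrategy.psi T g β (yδ δ)) a α →
      ‖FunctionalStrategy.regSol T g α (yδ δ) - x‖
        ≤ C * max (φ (φ (FunctionalStrategy.thetaInv φ δ)))
            (φ (FunctionalStrategy.thetaInv φ δ))) ∧
    (∃ C > 0, ∀ᶠ δ in 𝓝[>] (0 : ℝ), ∀ α : ℝ,
      FunctionalStrategy.IsArgmin (fun β => FunctionalStrategy.psi T g β (yδ δ)) a α →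
      ‖inner 𝕜 f (FunctionalStrategy.regSol T g α (yδ δ) - x)‖
        ≤ C * max ((κ * φ) (φ (FunctionalStrategy.thetaInv φ δ)))
            (φ (FunctionalStrategy.thetaInv φ δ))) ∧
    (∃ C > 0, ∀ᶠ δ in 𝓝[>] (0 : ℝ), ∀ α : ℝ,
      FunctionalStrategy.IsArgmin (fun β => FunctionalStrategy.psiKappa T g κ β (yδ δ)) a α →
      ‖inner 𝕜 f (FunctionalStrategy.regSol T g α (yδ δ) - x)‖
        ≤ C * max ((κ * φ) ((κ * φ) (FunctionalStrategy.thetaInv φ δ)))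
            ((κ * φ) (FunctionalStrategy.thetaInv φ δ))) := by
  open FunctionalStrategy in
  obtain ⟨w, rfl⟩ := hx
  obtain ⟨u, rfl⟩ := hf
  subst hxy
  have hp := isPositive_TstarT T
  have hadκ := hκ.admissible hp (injective_TstarT hT)
  have hκpos : ∀ t > 0, 0 < κ t := fun t ht => hA.kappa_pos hκ hκ0 ht
  -- If φ vanished identically on (0, ∞), then φ(T*T) = 0, so x = 0 and y = 0.
  have hφ0 : ∃ t > 0, φ t ≠ 0 := by
    by_contra! h0
    refine hy ?_
    have h1 := norm_funCalc_le hp (injective_TstarT hT) (hφ.admissible hp (injective_TstarT hT))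
      le_rfl (fun t ht => by rw [h0 t ht, abs_zero]) w
    rw [zero_mul, norm_le_zero_iff] at h1
    rw [h1, map_zero]
  have hφpos : ∀ t > 0, 0 < φ t := fun t ht => hA.phi_pos hφ (ha.trans_le haT) hφ0 ht
  obtain ⟨c, hc, hM⟩ := hN.muckenhouptAt
  have hM1 := hM.mono fun δ h => h.one hc hT hκ hκpos
  have hA1 := hA.one hφ
  have h1 := exists_rate hA1 hA1 hT hT' hg hφ isIndexFunction_one isIndexFunction_one hφpos
    (fun _ _ => one_pos) (fun _ _ => one_pos) hy hyδ hc hM1 ha haT (b := fun _ => 1) one_pos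
    (fun _ _ => zero_le_one) (fun _ _ => le_rfl) (by simp) (by simp)
  -- Error weight κ but minimized weight 1: take b = κ, bounded on (0, a] by κ(a).
  have h2 := exists_rate hA hA1 hT hT' hg hφ hκ isIndexFunction_one hφpos
    hκpos (fun _ _ => one_pos) hy hyδ hc hM ha haT (b := κ) (hκpos a ha)
    hκ.nonneg (fun α hα => hκ.monotoneOn hα.1 ha hα.2) (by simp)
    (fun α hα t ht => by simpa using hκ.monotoneOn ht.1 hα ht.2)
  have h3 := exists_rate hA hA hT hT' hg hφ hκ hκ hφpos hκpos hκpos hy hyδ hc hM ha haT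
    (b := fun _ => 1) one_pos (fun _ _ => zero_le_one) (fun _ _ => le_rfl) (by simp) (by simp)
  have hpsi : ∀ z, (fun β => psi T g β z) = fun β => psiKappa T g (fun _ => 1) β z :=
    fun z => funext fun β => psi_eq_psiKappa_one T g β z
  -- Self-adjointness moves κ(T*T) from f onto the error; ‖u‖ + 1 keeps the constant positive when u
  -- = 0.
  have hinner : ∀ {z : X} {C m : ℝ}, ‖funCalc (TstarT T) κ z‖ ≤ C * m → 0 < C →
      ‖inner 𝕜 (funCalc (TstarT T) κ u) z‖ ≤ (‖u‖ + 1) * C * m := by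
    intro z C m h hC
    have hm : 0 ≤ C * m := (norm_nonneg _).trans h
    rw [inner_funCalc hp hadκ]
    refine (norm_inner_le_norm _ _).trans ?_
    rw [mul_assoc]
    exact mul_le_mul (by linarith) h (norm_nonneg _) (by positivity)
  simp only [hpsi]
  refine ⟨?_, ?_, ?_⟩
  · obtain ⟨C, hC, h⟩ := h1
    refine ⟨C, hC, h.mono fun δ hδ α hα => ?_⟩
    simpa [funCalc_one hp] using hδ α hα
  · obtain ⟨C, hC, h⟩ := h2
    refine ⟨(‖u‖ + 1) * C, by positivity, h.mono fun δ hδ α hα => hinner ?_ hC⟩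
    simpa using hδ α hα
  · obtain ⟨C, hC, h⟩ := h3
    exact ⟨(‖u‖ + 1) * C, by positivity, h.mono fun δ hδ α hα => hinner (hδ α hα) hC⟩
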